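/- Consider a family of decomposable combinatorial objects: every object has a positive integer size, there are finitely many objects of each size, each object decomposes, uniquely up to ordering, into finitely many irreducible objects (of positive integer sizes), and the size of an object is the sum of the sizes of its irreducible components, counted with multiplicity. For each $n\ge 1$ let a probability distribution on the set of objects of size $n$ be given. For the random object of size $n$, let $C_i$ be the number of its irreducible components of size $i$, and let $l_1\ge l_2\ge\cdots$ be the sizes of its irreducible components in non-increasing order, padded with zeros. For $k\ge 1$, a good sequence of families of $k$-tuples consists of a family $F_n$, for each $n\ge1$, of $k$-tuples $(i_1,\dots,i_k)$ of distinct indices $1\le i_1,\dots,i_k\le n$, such that for some $\delta>0$ one has $i_j/n\ge\delta$ for all $n$, all $(i_1,\dots,i_k)\in F_n$ and all $j$. Let $\theta>0$. Suppose that, for every $k\ge1$ and every good sequence $(F_n)_{n\ge1}$ of families of $k$-tuples for which $m/n$ is bounded away from $1$ (that is, for some $\delta>0$ one has $m/n\le 1-\delta$ for all $n$ and all tuples in $F_n$), where $m=i_1+\cdots+i_k$, the expected values satisfy $$ E\{C_{i_1}\cdots C_{i_k}\}=\frac{\theta^k}{(1-m/n)^{1-\theta}}\,\frac{1}{i_1\cdots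 i_k}\,(1+o(1))\qquad (n\to\infty), $$ uniformly over the tuples $(i_1,\dots,i_k)\in F_n$. Then for every $k\ge1$, as $n\to\infty$, the random vector $(l_1/n,\dots,l_k/n)$ converges in distribution to $(X_1,\dots,X_k)$, the first $k$ coordinates of the Poisson--Dirichlet process $\mathrm{PD}(\theta)$. Here $X_1\ge X_2\ge\cdots$ is the sequence $G_1,G_2,\dots$ sorted into non-increasing order, where $G_j=V_1\cdots V_{j-1}(1-V_j)$, $V_i=U_i^{1/\theta}$, and $U_1,U_2,\dots$ are independent and uniform on $[0,1]$. -/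

import Mathlib

open MeasureTheory ProbabilityTheory Filter Topology

/-- A family of decomposable combinatorial objects.  Objects have positive integer sizes, there are
finitely many objects of each size, and every object has a well-defined finite multiset of
irreducible components (its decomposition, unique up to ordering), whose sizes are positive and add
up to the size of the object.  The irreducible objects form the type `Irr`; they may, but need not,
be literally a subtype of `Obj`.  Different objects may have the same multiset of components. -/
structure DecomposableFamily (Obj : Type*) (Irr : Type*) where
  size : Obj → ℕ
  size_pos : ∀ o, 0 < size o
  finite_size : ∀ n, {o | size o = n}.Finite
  irrSize : Irr → ℕ
  irrSize_pos : ∀ c, 0 < irrSize c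
  components : Obj → Multiset Irr
  size_eq_sum : ∀ o, size o = ((components o).map irrSize).sum

namespace DecomposableFamily

variable {Obj Irr : Type*} (D : DecomposableFamily Obj Irr)

/-- The (finite) sample space of the objects of size `n`. -/
def OfSize (n : ℕ+) : Type _ := {o : Obj // D.size o = n}

instance (n : ℕ+) : Finite (D.OfSize n) := (D.finite_size n).to_subtype

/-- Every set of objects of size `n` is an event. -/
instance (n : ℕ+) : MeasurableSpace (D.OfSize n) := ⊤

instance (n : ℕ+) : DiscreteMeasurableSpace (D.OfSize n) := ⟨fun _ => trivial⟩

variable {D} {n : ℕ+}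

/-- The multiset of the sizes of the irreducible components, with multiplicities. -/
def componentSizes (o : D.OfSize n) : Multiset ℕ := (D.components o.1).map D.irrSize

/-- The component count `C_i`: the number of irreducible components of size `i`. -/
def componentCount (o : D.OfSize n) (i : ℕ) : ℕ := (componentSizes o).count i

/-- The size of the `j`-th largest irreducible component, with `j` counted from `0`, and `0` if
there are at most `j` components. -/
def largestComponent (o : D.OfSize n) (j : ℕ) : ℕ :=
  ((componentSizes o).sort (· ≥ ·)).getD j 0

end DecomposableFamily

/-- A good sequence of families of `k`-tuples: for each `n` a family of `k`-tuples of distinct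
indices in `{1, …, n}`, with all the ratios `i_j / n` bounded away from `0`, uniformly over the
whole sequence. -/
def IsGoodSequence {k : ℕ} (F : ℕ+ → Set (Fin k → ℕ)) : Prop :=
  (∀ n, ∀ i ∈ F n, Function.Injective i ∧ ∀ j, 1 ≤ i j ∧ i j ≤ n) ∧
    ∃ δ : ℝ, 0 < δ ∧ ∀ n, ∀ i ∈ F n, ∀ j, δ ≤ (i j : ℝ) / (n : ℝ)

/-- The `k`-th largest term (with `k` counted from `0`) of a sequence, counting multiplicities:
the supremum of the levels `t` such that at least `k + 1` terms are `≥ t`. -/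
noncomputable def sortDesc (G : ℕ → ℝ) (k : ℕ) : ℝ :=
  sSup {t : ℝ | ((k + 1 : ℕ) : ℕ∞) ≤ {i : ℕ | t ≤ G i}.encard}

/-- `sortDesc` is sorting into non-increasing order: it returns the non-increasing rearrangement
of the sequence whenever there is one. -/
theorem sortDesc_eq_of_antitone (X : ℕ → ℝ) (hX : Antitone X) (σ : Equiv.Perm ℕ) (k : ℕ) :
    sortDesc (X ∘ σ) k = X k := by
  have key : {t : ℝ | ((k + 1 : ℕ) : ℕ∞) ≤ {i : ℕ | t ≤ (X ∘ σ) i}.encard} = Set.Iic (X k) := by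
    ext t
    have h1 : {i : ℕ | t ≤ (X ∘ σ) i}.encard = {i : ℕ | t ≤ X i}.encard := by
      rw [← (σ.injective.encard_image {i : ℕ | t ≤ (X ∘ σ) i})]
      congr 1
      ext i
      simp only [Set.mem_image, Set.mem_ofPred_eq, Function.comp]
      exact ⟨fun ⟨x, hx, hxi⟩ => hxi ▸ hx, fun h => ⟨σ.symm i, by simpa using h, by simp⟩⟩
    change ((k + 1 : ℕ) : ℕ∞) ≤ {i : ℕ | t ≤ (X ∘ σ) i}.encard ↔ t ≤ X k
    rw [h1]
    constructor
    · intro h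
      by_contra hlt
      have hsub : {i : ℕ | t ≤ X i} ⊆ (Finset.range k : Set ℕ) := by
        intro i hi
        simp only [Finset.coe_range, Set.mem_Iio]
        by_contra hik
        exact hlt (le_trans hi (hX (not_lt.mp hik)))
      have h2 := h.trans (Set.encard_le_encard hsub)
      rw [Set.encard_coe_eq_coe_finsetCard, Finset.card_range] at h2
      have h3 : k + 1 ≤ k := by exact_mod_cast h2
      omega
    · intro h
      have hsub : (Finset.range (k + 1) : Set ℕ) ⊆ {i : ℕ | t ≤ X i} := by
        intro i hi
        simp only [Finset.coe_range, Set.mem_Iio] at hi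
        exact h.trans (hX (by omega))
      have h2 := Set.encard_le_encard hsub
      rwa [Set.encard_coe_eq_coe_finsetCard, Finset.card_range] at h2
  rw [sortDesc, key, csSup_Iic]

/-- The law of an i.i.d. sequence `U_0, U_1, …` of uniform random variables on `[0,1]`. -/
noncomputable def iidUniform : Measure (ℕ → unitInterval) :=
  Measure.infinitePi fun _ => (volume : Measure unitInterval)

instance : IsProbabilityMeasure iidUniform := by
  unfold iidUniform; infer_instance

/-- The terms `G_j = V_0 ⋯ V_{j-1} (1 - V_j)` with `V_i = U_i^{1/θ}`. -/
noncomputable def stickBreaking (θ : ℝ) (u : ℕ → unitInterval) (j : ℕ) : ℝ :=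
  (∏ i ∈ Finset.range j, (u i : ℝ) ^ (1 / θ)) * (1 - (u j : ℝ) ^ (1 / θ))

/-- The Poisson–Dirichlet process with parameter `θ`, as a sequence of random variables on the
probability space of `iidUniform`: the sequence `stickBreaking θ` sorted into non-increasing
order. -/
noncomputable def poissonDirichlet (θ : ℝ) (u : ℕ → unitInterval) (j : ℕ) : ℝ :=
  sortDesc (stickBreaking θ u) j

/-! The proof passes through the size-biased permutation. From an object of size `n`, draw
components one at a time, each with probability proportional to its size among those that remain.
The first `K` have given distinct sizes `i_1, …, i_K` with probability `∏ C_{i_j} i_j / (n - i_1 - ⋯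
- i_{j-1})`. Its expectation is an explicit constant times the mixed moment of the hypothesis, hence
asymptotic to `n^{-K}` times a function of `i/n`, and that function is the joint density of the
stick-breaking terms `G_1, …, G_K` (`lintegral_stickTuple`). The asymptotics are uniform on compact
sets of positive tuples with distinct entries and sum below one, so Riemann sums give convergence of
expectations of continuous functions supported in such a set (`tendsto_sizeBiasedMean`).

No mass is lost. The limit density integrates to one and charges only tuples with distinct entries,
so some cutoff `φ` captures mass at least `1 - η` in the limit. The weights for finite `n` sum to at
most one, so whatever `φ` misses is small there too.

Sorting restores the order. The sorted tuple depends on the tuple in a 1-Lipschitz way, and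
replacing the full list of components, or the full stick-breaking sequence, by its first `K` terms
moves the sorted values by at most the residual mass `1 - ∑ x_j`. In the limit this residual has
mean `(θ/(θ+1))^K`, which is small for large `K`. Bounded Lipschitz test functions then give
convergence in distribution. -/

/-! ### Stability of sorting -/

theorem sortDesc_level_bddAbove {a : ℕ → ℝ} {M : ℝ} (haM : ∀ i, a i ≤ M) (k : ℕ) :
    BddAbove {t : ℝ | ((k + 1 : ℕ) : ℕ∞) ≤ {i : ℕ | t ≤ a i}.encard} := by
  refine ⟨M, fun t ht => ?_⟩
  have hne : {i : ℕ | t ≤ a i}.Nonempty := by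
    rw [← Set.encard_pos]
    exact lt_of_lt_of_le (by exact_mod_cast Nat.succ_pos k) ht
  obtain ⟨i, hi⟩ := hne
  exact le_trans hi (haM i)

theorem sortDesc_level_of_nonpos {a : ℕ → ℝ} (ha0 : ∀ i, 0 ≤ a i) (k : ℕ) {t : ℝ} (ht : t ≤ 0) :
    ((k + 1 : ℕ) : ℕ∞) ≤ {i : ℕ | t ≤ a i}.encard := by
  have : {i : ℕ | t ≤ a i} = Set.univ := by
    ext i
    simpa using ht.trans (ha0 i)
  rw [this, Set.encard_univ]
  simp

theorem sortDesc_nonneg {a : ℕ → ℝ} {M : ℝ} (ha0 : ∀ i, 0 ≤ a i) (haM : ∀ i, a i ≤ M) (k : ℕ) :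
    0 ≤ sortDesc a k :=
  le_csSup (sortDesc_level_bddAbove haM k) (sortDesc_level_of_nonpos ha0 k le_rfl)

/-- `sortDesc` is monotone up to a shift, in terms of the counting functions. -/
theorem sortDesc_le_sortDesc_add {a b : ℕ → ℝ} {M r : ℝ} {k : ℕ} (ha0 : ∀ i, 0 ≤ a i)
    (haM : ∀ i, a i ≤ M) (hb0 : ∀ i, 0 ≤ b i)
    (h : ∀ t, 0 < t → {i | t + r ≤ b i}.encard ≤ {i | t ≤ a i}.encard) :
    sortDesc b k ≤ sortDesc a k + r := by
  refine csSup_le ⟨0, sortDesc_level_of_nonpos hb0 k le_rfl⟩ fun t ht => ?_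
  rcases le_or_gt t r with htr | htr
  · linarith [sortDesc_nonneg ha0 haM k]
  · have h1 : ((k + 1 : ℕ) : ℕ∞) ≤ {i : ℕ | t - r ≤ a i}.encard := by
      refine le_trans ?_ (h (t - r) (by linarith))
      simpa using ht
    have h2 : t - r ≤ sortDesc a k := le_csSup (sortDesc_level_bddAbove haM k) h1
    linarith

theorem abs_sortDesc_sub_le {a b : ℕ → ℝ} {M r : ℝ} (k : ℕ) (ha0 : ∀ i, 0 ≤ a i)
    (haM : ∀ i, a i ≤ M) (hb0 : ∀ i, 0 ≤ b i) (hbM : ∀ i, b i ≤ M)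
    (h : ∀ i, |a i - b i| ≤ r) : |sortDesc a k - sortDesc b k| ≤ r := by
  have h1 : sortDesc b k ≤ sortDesc a k + r := by
    refine sortDesc_le_sortDesc_add ha0 haM hb0 fun t _ => Set.encard_le_encard fun i hi => ?_
    have := abs_le.1 (h i)
    simp only [Set.mem_ofPred_eq] at hi ⊢
    linarith
  have h2 : sortDesc a k ≤ sortDesc b k + r := by
    refine sortDesc_le_sortDesc_add hb0 hbM ha0 fun t _ => Set.encard_le_encard fun i hi => ?_
    have := abs_le.1 (h i)
    simp only [Set.mem_ofPred_eq] at hi ⊢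
    linarith
  rw [abs_le]
  constructor <;> linarith

/-- For nonnegative sequences a level `t ≤ 0` is reached by every index, so only the counts at
positive levels carry information. -/
theorem sortDesc_congr_encard {a b : ℕ → ℝ} (k : ℕ) (ha0 : ∀ i, 0 ≤ a i) (hb0 : ∀ i, 0 ≤ b i)
    (h : ∀ t, 0 < t → {i | t ≤ a i}.encard = {i | t ≤ b i}.encard) :
    sortDesc a k = sortDesc b k := by
  unfold sortDesc
  congr 1
  ext t
  simp only [Set.mem_ofPred_eq]
  rcases le_or_gt t 0 with ht | ht
  · exact iff_of_true (sortDesc_level_of_nonpos ha0 k ht) (sortDesc_level_of_nonpos hb0 k ht)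
  · rw [h t ht]

theorem encard_getD_eq_countP {α : Type*} (p : α → Prop) [DecidablePred p] (d : α)
    (hd : ¬ p d) (L : List α) : {i : ℕ | p (L.getD i d)}.encard = (L.countP p : ℕ) := by
  induction L with
  | nil => simp [hd]
  | cons a L ih =>
    have h1 : {i : ℕ | p ((a :: L).getD i d)} =
        {i | i = 0 ∧ p a} ∪ Nat.succ '' {i : ℕ | p (L.getD i d)} := by
      ext i
      cases i <;> simp
    have hdis : Disjoint {i : ℕ | i = 0 ∧ p a} (Nat.succ '' {i : ℕ | p (L.getD i d)}) := by
      rw [Set.disjoint_left]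
      rintro i ⟨rfl, -⟩ ⟨j, -, hj⟩
      exact absurd hj (Nat.succ_ne_zero j)
    rw [h1, Set.encard_union_eq hdis, Nat.succ_injective.encard_image, ih, List.countP_cons]
    by_cases ha : p a
    · have : {i : ℕ | i = 0 ∧ p a} = {0} := by ext; simp [ha]
      rw [this]
      simp [ha, add_comm]
    · have : {i : ℕ | i = 0 ∧ p a} = ∅ := by ext; simp [ha]
      rw [this]
      simp [ha]

/-- The padding zeros never reach a positive level, so only the multiset of entries matters. -/
theorem sortDesc_getD_perm {L L' : List ℕ} (hL : L.Perm L') {c : ℝ} (hc : 0 ≤ c) (k : ℕ) :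
    sortDesc (fun q => (L.getD q 0 : ℝ) / c) k = sortDesc (fun q => (L'.getD q 0 : ℝ) / c) k := by
  refine sortDesc_congr_encard k (fun i => by positivity) (fun i => by positivity) fun t ht => ?_
  have h0 : ¬ (t ≤ ((0 : ℕ) : ℝ) / c) := by simpa using ht
  classical
  rw [encard_getD_eq_countP (fun x : ℕ => t ≤ (x : ℝ) / c) 0 h0 L,
    encard_getD_eq_countP (fun x : ℕ => t ≤ (x : ℝ) / c) 0 h0 L', hL.countP_eq]

/-- A tuple, made nonnegative by truncation at `0` and continued by zeros. -/
noncomputable def padZero {K : ℕ} (x : Fin K → ℝ) (i : ℕ) : ℝ :=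
  if h : i < K then max (x ⟨i, h⟩) 0 else 0

theorem padZero_nonneg {K : ℕ} (x : Fin K → ℝ) (i : ℕ) : 0 ≤ padZero x i := by
  unfold padZero
  split_ifs <;> simp

theorem padZero_le {K : ℕ} (x : Fin K → ℝ) (i : ℕ) : padZero x i ≤ ‖x‖ := by
  unfold padZero
  split_ifs with h
  · exact max_le ((le_abs_self _).trans (norm_le_pi_norm x ⟨i, h⟩)) (norm_nonneg _)
  · exact norm_nonneg _

theorem abs_padZero_sub_le {K : ℕ} (x y : Fin K → ℝ) (i : ℕ) :
    |padZero x i - padZero y i| ≤ dist x y := by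
  unfold padZero
  split_ifs with h
  · exact (abs_max_sub_max_le_abs _ _ _).trans
      ((Real.dist_eq _ _).symm.le.trans (dist_le_pi_dist x y ⟨i, h⟩))
  · simp

/-- The `k` largest entries of a tuple, in non-increasing order. -/
noncomputable def topSorted {K : ℕ} (k : ℕ) (x : Fin K → ℝ) (j : Fin k) : ℝ :=
  sortDesc (padZero x) j

theorem lipschitzWith_topSorted (K k : ℕ) : LipschitzWith 1 (topSorted (K := K) k) := by
  refine LipschitzWith.of_dist_le_mul fun x y => ?_
  rw [NNReal.coe_one, one_mul, dist_pi_le_iff dist_nonneg]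
  intro j
  rw [Real.dist_eq]
  exact abs_sortDesc_sub_le j (padZero_nonneg x)
    (fun i => (padZero_le x i).trans (le_max_left _ ‖y‖)) (padZero_nonneg y)
    (fun i => (padZero_le y i).trans (le_max_right _ _)) (abs_padZero_sub_le x y)

/-- The truncated and the full sequence agree on the first `K` terms and differ by at most `r`
afterwards. This serves both for the components of an object and for stick-breaking, with `r` the
residual mass. -/
theorem abs_topSorted_sub_sortDesc_le {K k : ℕ} {x : Fin K → ℝ} (hx : ∀ i, 0 ≤ x i)
    {G : ℕ → ℝ} {M r : ℝ} (hr : 0 ≤ r) (hG : ∀ i, 0 ≤ G i) (hM : ∀ i, G i ≤ M)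
    (hhead : ∀ i : Fin K, G i = x i)
    (htail : ∀ i, K ≤ i → G i ≤ r) (j : Fin k) : |topSorted k x j - sortDesc G j| ≤ r := by
  refine abs_sortDesc_sub_le j (padZero_nonneg x)
    (fun i => (padZero_le x i).trans (le_max_left _ M)) hG
    (fun i => (hM i).trans (le_max_right _ _)) fun i => ?_
  unfold padZero
  split_ifs with h
  · rw [max_eq_left (hx _), ← hhead ⟨i, h⟩]
    simpa using hr
  · rw [zero_sub, abs_neg, abs_of_nonneg (hG i)]
    exact htail i (not_lt.1 h)

/-! ### Size-biased weights -/

/-- The sum of the entries of a tuple before the `j`-th. -/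
def headSum {K : ℕ} {M : Type*} [AddCommMonoid M] (x : Fin K → M) (j : Fin K) : M :=
  ∑ i ∈ Finset.Iio j, x i

theorem headSum_snoc_castSucc {K : ℕ} {M : Type*} [AddCommMonoid M] (x : Fin K → M) (y : M)
    (j : Fin K) : headSum (Fin.snoc x y : Fin (K + 1) → M) j.castSucc = headSum x j := by
  unfold headSum
  rw [← Fin.map_castSuccEmb_Iio, Finset.sum_map]
  simp

theorem headSum_snoc_last {K : ℕ} {M : Type*} [AddCommMonoid M] (x : Fin K → M) (y : M) :
    headSum (Fin.snoc x y : Fin (K + 1) → M) (Fin.last K) = ∑ i, x i := by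
  unfold headSum
  have : Finset.Iio (Fin.last K) = Finset.univ.map Fin.castSuccEmb := by
    ext i
    induction i using Fin.lastCases <;> simp
  rw [this, Finset.sum_map]
  simp

theorem headSum_le_sum {K : ℕ} {x : Fin K → ℝ} (hx : ∀ i, 0 ≤ x i) (j : Fin K) :
    headSum x j + x j ≤ ∑ i, x i := by
  unfold headSum
  rw [add_comm, ← Finset.sum_insert (by simp)]
  exact Finset.sum_le_sum_of_subset_of_nonneg (Finset.subset_univ _) fun i _ _ => hx i

/-- If there are `c i` components of size `i` and the sizes sum to `n`, the probability that the
first `K` components, in size-biased order, have the distinct sizes `i 0, …, i (K - 1)`. -/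
noncomputable def sizeBiasedWeight (n : ℕ) {K : ℕ} (i : Fin K → ℕ) (c : ℕ → ℕ) : ℝ :=
  ∏ j, ((c (i j) : ℝ) * i j) / (n - headSum (fun l => (i l : ℝ)) j)

theorem sizeBiasedWeight_snoc (n : ℕ) {K : ℕ} (i : Fin K → ℕ) (y : ℕ) (c : ℕ → ℕ) :
    sizeBiasedWeight n (Fin.snoc i y : Fin (K + 1) → ℕ) c =
      sizeBiasedWeight n i c * (((c y : ℝ) * y) / (n - ∑ j, (i j : ℝ))) := by
  unfold sizeBiasedWeight
  have h : (fun l => ((Fin.snoc i y : Fin (K + 1) → ℕ) l : ℝ)) =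
      (Fin.snoc (fun l => (i l : ℝ)) (y : ℝ) : Fin (K + 1) → ℝ) := by
    ext l
    induction l using Fin.lastCases <;> simp
  rw [Fin.prod_univ_castSucc, h, headSum_snoc_last]
  simp only [headSum_snoc_castSucc, Fin.snoc_castSucc, Fin.snoc_last]

theorem count_ne_zero_of_sizeBiasedWeight_ne_zero {n K : ℕ} {i : Fin K → ℕ} {c : ℕ → ℕ}
    (h : sizeBiasedWeight n i c ≠ 0) (j : Fin K) : c (i j) ≠ 0 := by
  intro h0
  exact h (Finset.prod_eq_zero (Finset.mem_univ j) (by simp [h0]))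

/-- Each chosen size occurs at least once, so it uses up at least `i j` of the total mass `n`. This
controls the denominators of the weights and the mass left for the next draw. -/
theorem sum_add_sum_notMem_range_le {n K : ℕ} {c : ℕ → ℕ}
    (hc : ∑ y : Fin (n + 1), (c y : ℝ) * (y : ℕ) = n) {i : Fin K → Fin (n + 1)}
    (hi : Function.Injective i) (hpos : ∀ j, c (i j) ≠ 0) :
    ∑ j, ((i j : ℕ) : ℝ) +
      ∑ y ∈ (Finset.univ.image i)ᶜ, (c y : ℝ) * ((y : ℕ) : ℝ) ≤ n := by
  rw [← hc, ← Finset.sum_add_sum_compl (Finset.univ.image i), Finset.sum_image hi.injOn]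
  gcongr with j _
  have : (1 : ℝ) ≤ c (i j) := by exact_mod_cast Nat.one_le_iff_ne_zero.2 (hpos j)
  exact le_mul_of_one_le_left (by positivity) this

/-- A denominator can be negative only when the chosen sizes do not all occur in the object, and
then a factor `c (i j)` vanishes. -/
theorem sizeBiasedWeight_nonneg {n K : ℕ} {c : ℕ → ℕ}
    (hc : ∑ y : Fin (n + 1), (c y : ℝ) * (y : ℕ) = n) {i : Fin K → Fin (n + 1)}
    (hi : Function.Injective i) : 0 ≤ sizeBiasedWeight n (fun j => (i j : ℕ)) c := by
  by_cases h : sizeBiasedWeight n (fun j => (i j : ℕ)) c = 0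
  · exact h.ge
  have h1 := sum_add_sum_notMem_range_le hc hi (count_ne_zero_of_sizeBiasedWeight_ne_zero h)
  have h2 : 0 ≤ ∑ y ∈ (Finset.univ.image i)ᶜ, (c y : ℝ) * ((y : ℕ) : ℝ) :=
    Finset.sum_nonneg fun y _ => by positivity
  refine Finset.prod_nonneg fun j _ => div_nonneg (by positivity) ?_
  have h3 := headSum_le_sum (x := fun l => ((i l : ℕ) : ℝ)) (fun l => by positivity) j
  have h4 : (0 : ℝ) ≤ ((i j : ℕ) : ℝ) := by positivity
  linarith

-- Given the first `K` sizes, the next draw hits a new size with probability at most one. Equality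
-- may fail because components repeating an earlier size are left out.
open Classical in
theorem sum_sizeBiasedWeight_le_one {n : ℕ} {c : ℕ → ℕ}
    (hc : ∑ y : Fin (n + 1), (c y : ℝ) * (y : ℕ) = n) (K : ℕ) :
    ∑ i : Fin K → Fin (n + 1),
      (if Function.Injective i then sizeBiasedWeight n (fun j => (i j : ℕ)) c else 0) ≤ 1 := by
  induction K with
  | zero => simp [sizeBiasedWeight, Function.injective_of_subsingleton]
  | succ K ih =>
    refine le_trans ?_ ih
    rw [← (Fin.snocEquiv fun _ => Fin (n + 1)).sum_comp, Fintype.sum_prod_type_right]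
    refine Finset.sum_le_sum fun i _ => ?_
    have hsnoc : ∀ y : Fin (n + 1), (fun j => (((Fin.snocEquiv fun _ => Fin (n + 1)) (y, i) :
        Fin (K + 1) → Fin (n + 1)) j : ℕ)) =
          (Fin.snoc (fun j => (i j : ℕ)) (y : ℕ) : Fin (K + 1) → ℕ) := by
      intro y
      ext l
      induction l using Fin.lastCases <;> simp [Fin.snocEquiv]
    have hinj : ∀ y : Fin (n + 1), Function.Injective ((Fin.snocEquiv fun _ => Fin (n + 1)) (y, i) :
        Fin (K + 1) → Fin (n + 1)) ↔ Function.Injective i ∧ y ∉ Set.range i := by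
      intro y
      exact Fin.snoc_injective_iff
    simp only [hsnoc, hinj, sizeBiasedWeight_snoc]
    by_cases hi : Function.Injective i
    swap
    · simp [hi]
    rw [if_pos hi]
    by_cases h0 : sizeBiasedWeight n (fun j => (i j : ℕ)) c = 0
    · simp [h0]
    have h1 := sum_add_sum_notMem_range_le hc hi (count_ne_zero_of_sizeBiasedWeight_ne_zero h0)
    have h2 : ∑ y : Fin (n + 1), (if Function.Injective i ∧ y ∉ Set.range i then
        sizeBiasedWeight n (fun j => (i j : ℕ)) c * (((c y : ℝ) * (y : ℕ)) /
          (n - ∑ j, ((i j : ℕ) : ℝ))) else 0) =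
        sizeBiasedWeight n (fun j => (i j : ℕ)) c *
          ((∑ y ∈ (Finset.univ.image i)ᶜ, (c y : ℝ) * ((y : ℕ) : ℝ)) /
            (n - ∑ j, ((i j : ℕ) : ℝ))) := by
      rw [Finset.sum_div, Finset.mul_sum, ← Finset.sum_filter]
      refine Finset.sum_congr ?_ fun _ _ => rfl
      ext y
      simp [hi]
    rw [h2]
    refine mul_le_of_le_one_right (sizeBiasedWeight_nonneg hc hi) (div_le_one_of_le₀ ?_ ?_)
    · linarith
    · have : 0 ≤ ∑ y ∈ (Finset.univ.image i)ᶜ, (c y : ℝ) * ((y : ℕ) : ℝ) :=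
        Finset.sum_nonneg fun y _ => by positivity
      linarith

/-! ### Components of an object and their order -/

theorem antitone_getD_of_pairwise {L : List ℕ} (hL : L.Pairwise (· ≥ ·)) :
    Antitone fun q => L.getD q 0 := by
  intro a b hab
  rcases hab.eq_or_lt with rfl | hlt
  · exact le_rfl
  by_cases hb : b < L.length
  · have := List.pairwise_iff_getElem.1 hL a b (hlt.trans hb) hb hlt
    simpa [List.getD_eq_getElem, hb, hlt.trans hb] using this
  · simp only [List.getD_eq_default _ _ (not_lt.1 hb), zero_le]

namespace DecomposableFamily

variable {Obj Irr : Type*} {D : DecomposableFamily Obj Irr} {n : ℕ+}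

theorem sum_componentSizes (o : D.OfSize n) : (componentSizes o).sum = n := by
  rw [componentSizes, ← D.size_eq_sum, o.2]

theorem sum_componentCount_mul (o : D.OfSize n) :
    ∑ y : Fin ((n : ℕ) + 1), (componentCount o y : ℝ) * (y : ℕ) = (n : ℕ) := by
  have h1 : (∑ y : Fin ((n : ℕ) + 1), componentCount o y * (y : ℕ)) = (n : ℕ) := by
    rw [Fin.sum_univ_eq_sum_range (fun y => componentCount o y * y)]
    conv_rhs => rw [← sum_componentSizes o, Finset.sum_multiset_count]
    symm
    refine Finset.sum_subset (fun y hy => ?_) fun y _ hy => ?_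
    · rw [Finset.mem_range, Nat.lt_succ_iff, ← sum_componentSizes o]
      exact Multiset.le_sum_of_mem (Multiset.mem_toFinset.1 hy)
    · rw [Multiset.mem_toFinset] at hy
      simp [hy]
  exact_mod_cast h1

theorem largestComponent_div_eq_sortDesc (o : D.OfSize n) (j : ℕ) :
    (largestComponent o j : ℝ) / n =
      sortDesc (fun q => (((componentSizes o).sort (· ≥ ·)).getD q 0 : ℝ) / n) j := by
  have h : Antitone fun q => (((componentSizes o).sort (· ≥ ·)).getD q 0 : ℝ) / n := by
    intro a b hab
    have h1 := antitone_getD_of_pairwise (Multiset.pairwise_sort (componentSizes o) (· ≥ ·)) hab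
    simp only at h1 ⊢
    gcongr
  exact (sortDesc_eq_of_antitone _ h (Equiv.refl ℕ) j).symm

/-- List the chosen components first and the remaining ones `R` after them. The sizes in `R` add up
to `n - ∑ i l`, so each of them is at most the residual mass. -/
theorem abs_topSorted_sub_largestComponent_le {K k : ℕ} (o : D.OfSize n) {i : Fin K → ℕ}
    (hi : Function.Injective i) (hc : ∀ j, componentCount o (i j) ≠ 0) (j : Fin k) :
    |topSorted k (fun l => (i l : ℝ) / n) j - (largestComponent o j : ℝ) / n| ≤
      1 - ∑ l, (i l : ℝ) / n := by
  have hn : (0 : ℝ) < n := by exact_mod_cast n.pos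
  obtain ⟨R, hR⟩ : ∃ R : Multiset ℕ, componentSizes o = (List.ofFn i : Multiset ℕ) + R := by
    have hle : (List.ofFn i : Multiset ℕ) ≤ componentSizes o := by
      rw [Multiset.le_iff_subset (by simpa using List.nodup_ofFn.2 hi)]
      intro y hy
      rw [Multiset.mem_coe, List.mem_ofFn] at hy
      obtain ⟨l, rfl⟩ := hy
      exact Multiset.count_ne_zero.1 (hc l)
    exact Multiset.le_iff_exists_add.1 hle
  have hsum : ∑ l, (i l : ℝ) + R.sum = n := by
    have h := sum_componentSizes o
    rw [hR, Multiset.sum_add, Multiset.sum_coe, List.sum_ofFn] at h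
    exact_mod_cast h
  have hr : 1 - ∑ l, (i l : ℝ) / n = (R.sum : ℝ) / n := by
    rw [← Finset.sum_div, eq_div_iff hn.ne', sub_mul, div_mul_cancel₀ _ hn.ne']
    linarith
  have hperm : ((componentSizes o).sort (· ≥ ·)).Perm (List.ofFn i ++ R.toList) := by
    rw [← Multiset.coe_eq_coe, Multiset.sort_eq, hR, ← Multiset.coe_add, Multiset.coe_toList]
  have hmem : ∀ q, (List.ofFn i ++ R.toList).getD q 0 ≤ (n : ℕ) := by
    intro q
    by_cases hq : q < (List.ofFn i ++ R.toList).length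
    · rw [List.getD_eq_getElem _ _ hq, ← sum_componentSizes o]
      refine Multiset.le_sum_of_mem ?_
      rw [← Multiset.sort_eq (componentSizes o) (· ≥ ·), Multiset.mem_coe, hperm.mem_iff]
      exact List.getElem_mem hq
    · simp only [List.getD_eq_default _ _ (not_lt.1 hq), zero_le]
  rw [largestComponent_div_eq_sortDesc, sortDesc_getD_perm hperm hn.le, hr]
  refine abs_topSorted_sub_sortDesc_le (M := 1) (fun l => by positivity) (by positivity)
    (fun q => by positivity) (fun q => ?_) (fun l => ?_) (fun q hq => ?_) j
  · rw [div_le_one hn]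
    exact_mod_cast hmem q
  · rw [List.getD_append _ _ _ _ (by simp)]
    simp
  · rw [List.getD_append_right _ _ _ _ (by simpa using hq)]
    gcongr
    by_cases hq' : q - (List.ofFn i).length < R.toList.length
    · rw [List.getD_eq_getElem _ _ hq']
      exact Multiset.le_sum_of_mem (Multiset.mem_toList.1 (List.getElem_mem hq'))
    · simp only [List.getD_eq_default _ _ (not_lt.1 hq'), zero_le]

end DecomposableFamily

/-! ### Joint density of the stick-breaking terms -/

/-- The open simplex of the tuples with positive entries and sum less than one. -/
def openSimplex (K : ℕ) : Set (Fin K → ℝ) := {x | (∀ i, 0 < x i) ∧ ∑ i, x i < 1}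

theorem isOpen_openSimplex (K : ℕ) : IsOpen (openSimplex K) := by
  have : openSimplex K = (⋂ i, {x | 0 < x i}) ∩ {x | ∑ i, x i < 1} := by ext; simp [openSimplex]
  rw [this]
  exact (isOpen_iInter_of_finite fun i => isOpen_lt continuous_const (continuous_apply i)).inter
    (isOpen_lt (by fun_prop) continuous_const)

/-- The density of the first `K` terms of the stick-breaking sequence on the open simplex. -/
noncomputable def gemDensity (θ : ℝ) {K : ℕ} (x : Fin K → ℝ) : ℝ :=
  θ ^ K * (1 - ∑ i, x i) ^ (θ - 1) / ∏ j, (1 - headSum x j)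

theorem one_sub_headSum_pos {K : ℕ} {x : Fin K → ℝ} (hx : x ∈ openSimplex K) (j : Fin K) :
    0 < 1 - headSum x j := by
  have h1 := headSum_le_sum (fun i => (hx.1 i).le) j
  have h2 := hx.1 j
  have h3 := hx.2
  linarith

theorem gemDensity_pos {θ : ℝ} (hθ : 0 < θ) {K : ℕ} {x : Fin K → ℝ} (hx : x ∈ openSimplex K) :
    0 < gemDensity θ x := by
  have h1 : 0 < 1 - ∑ i, x i := by linarith [hx.2]
  have h2 : 0 < ∏ j, (1 - headSum x j) := Finset.prod_pos fun j _ => one_sub_headSum_pos hx j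
  unfold gemDensity
  positivity

theorem continuousOn_gemDensity (θ : ℝ) (K : ℕ) :
    ContinuousOn (gemDensity θ (K := K)) (openSimplex K) := by
  unfold gemDensity headSum
  refine ContinuousOn.div ?_ (by fun_prop) fun x hx => ?_
  · refine continuousOn_const.mul (ContinuousOn.rpow_const (by fun_prop) fun x hx => Or.inl ?_)
    linarith [hx.2]
  · exact (Finset.prod_pos fun j _ => one_sub_headSum_pos hx j).ne'

theorem measurable_gemDensity (θ : ℝ) (K : ℕ) : Measurable (gemDensity θ (K := K)) := by
  unfold gemDensity headSum
  fun_prop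

theorem snoc_mem_openSimplex {K : ℕ} {x : Fin K → ℝ} {z : ℝ} :
    (Fin.snoc x z : Fin (K + 1) → ℝ) ∈ openSimplex (K + 1) ↔
      x ∈ openSimplex K ∧ z ∈ Set.Ioo 0 (1 - ∑ i, x i) := by
  simp only [openSimplex, Set.mem_ofPred_eq, Fin.forall_fin_succ', Fin.snoc_castSucc,
    Fin.snoc_last, Fin.sum_univ_castSucc, Set.mem_Ioo]
  constructor
  · rintro ⟨⟨h1, h2⟩, h3⟩
    exact ⟨⟨h1, by linarith⟩, h2, by linarith⟩
  · rintro ⟨⟨h1, -⟩, h2, h3⟩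
    exact ⟨⟨h1, h2⟩, by linarith⟩

/-- The second factor is the conditional density of the next term: that of `c (1 - U ^ (1 / θ))`,
where `c` is the length of stick that remains. -/
theorem gemDensity_snoc (θ : ℝ) {K : ℕ} {x : Fin K → ℝ} {z : ℝ}
    (hc : 0 < 1 - ∑ i, x i) (hz : z ≤ 1 - ∑ i, x i) :
    gemDensity θ (Fin.snoc x z : Fin (K + 1) → ℝ) = gemDensity θ x *
      (θ * (1 - z / (1 - ∑ i, x i)) ^ (θ - 1) / (1 - ∑ i, x i)) := by
  unfold gemDensity
  rw [Fin.prod_univ_castSucc, headSum_snoc_last, Fin.sum_univ_castSucc]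
  simp only [headSum_snoc_castSucc, Fin.snoc_castSucc, Fin.snoc_last]
  have h1 : 1 - (∑ i, x i + z) = (1 - ∑ i, x i) * (1 - z / (1 - ∑ i, x i)) := by
    field_simp
    ring
  rw [h1, Real.mul_rpow hc.le (by rw [sub_nonneg]; exact div_le_one_of_le₀ hz hc.le), pow_succ,
    div_mul_div_comm]
  ring

/-- The law of `c (1 - U ^ (1 / θ))` for `U` uniform on the unit interval. -/
theorem lintegral_unitInterval_comp {θ c : ℝ} (hθ : 0 < θ) (hc : 0 < c) (ψ : ℝ → ENNReal) :
    ∫⁻ y : unitInterval, ψ (c * (1 - (y : ℝ) ^ (1 / θ))) =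
      ∫⁻ z in Set.Ioo 0 c, ENNReal.ofReal (θ * (1 - z / c) ^ (θ - 1) / c) * ψ z := by
  have hbase : ∀ z ∈ Set.Ioo 0 c, 0 < 1 - z / c := fun z hz => by
    rw [sub_pos, div_lt_one hc]
    exact hz.2
  have hderiv : ∀ z ∈ Set.Ioo 0 c, HasDerivWithinAt (fun z => (1 - z / c) ^ θ)
      (-(1 / c) * θ * (1 - z / c) ^ (θ - 1)) (Set.Ioo 0 c) z := fun z hz =>
    ((((hasDerivAt_id z).div_const c).const_sub 1).rpow_const
      (Or.inl (hbase z hz).ne')).hasDerivWithinAt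
  have hanti : AntitoneOn (fun z => (1 - z / c) ^ θ) (Set.Ioo 0 c) := by
    intro a ha b hb hab
    have := hbase b hb
    simp only
    gcongr
  have himage : (fun z => (1 - z / c) ^ θ) '' Set.Ioo 0 c = Set.Ioo 0 1 := by
    ext y
    constructor
    · rintro ⟨z, hz, rfl⟩
      have h0 := hbase z hz
      have h1 : 0 < z / c := div_pos hz.1 hc
      exact ⟨Real.rpow_pos_of_pos h0 _, Real.rpow_lt_one h0.le (by linarith) hθ⟩
    · rintro ⟨h0, h1⟩
      have h2 : y ^ (1 / θ) < 1 := Real.rpow_lt_one h0.le h1 (by positivity)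
      have h3 : 0 < y ^ (1 / θ) := Real.rpow_pos_of_pos h0 _
      refine ⟨c * (1 - y ^ (1 / θ)), ⟨by nlinarith, by nlinarith⟩, ?_⟩
      simp only
      rw [mul_div_cancel_left₀ _ hc.ne', sub_sub_cancel, ← Real.rpow_mul h0.le,
        one_div_mul_cancel hθ.ne', Real.rpow_one]
  -- Substitute `y = (1 - z / c) ^ θ`, the decreasing inverse of `z = c (1 - y ^ (1 / θ))`.
  rw [unitInterval.volume_def,
    lintegral_subtype_comap measurableSet_Icc (fun y : ℝ => ψ (c * (1 - y ^ (1 / θ)))),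
    ← setLIntegral_congr (Ioo_ae_eq_Icc (μ := volume) (a := (0 : ℝ)) (b := 1)), ← himage,
    lintegral_image_eq_lintegral_deriv_mul_of_antitoneOn measurableSet_Ioo hderiv hanti]
  refine setLIntegral_congr_fun measurableSet_Ioo fun z hz => ?_
  congr 2
  · ring
  · rw [← Real.rpow_mul (hbase z hz).le, mul_one_div_cancel hθ.ne', Real.rpow_one]
    field_simp
    ring

theorem one_sub_sum_stickBreaking (θ : ℝ) (u : ℕ → unitInterval) (K : ℕ) :
    1 - ∑ j ∈ Finset.range K, stickBreaking θ u j =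
      ∏ i ∈ Finset.range K, (u i : ℝ) ^ (1 / θ) := by
  induction K with
  | zero => simp
  | succ K ih =>
    rw [Finset.sum_range_succ, Finset.prod_range_succ, ← ih, stickBreaking, ← ih]
    ring

/-- The first `K` terms of the stick-breaking sequence. -/
noncomputable def stickTuple (θ : ℝ) (K : ℕ) (u : ℕ → unitInterval) (j : Fin K) : ℝ :=
  stickBreaking θ u j

theorem one_sub_sum_stickTuple (θ : ℝ) (u : ℕ → unitInterval) (K : ℕ) :
    1 - ∑ j, stickTuple θ K u j = ∏ i ∈ Finset.range K, (u i : ℝ) ^ (1 / θ) := by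
  rw [← one_sub_sum_stickBreaking, Finset.sum_range]
  rfl

theorem stickTuple_succ (θ : ℝ) (u : ℕ → unitInterval) (K : ℕ) :
    stickTuple θ (K + 1) u = (Fin.snoc (stickTuple θ K u)
      ((1 - ∑ j, stickTuple θ K u j) * (1 - (u K : ℝ) ^ (1 / θ))) : Fin (K + 1) → ℝ) := by
  ext j
  rw [one_sub_sum_stickTuple]
  induction j using Fin.lastCases <;> simp [stickTuple, stickBreaking]

theorem measurable_stickBreaking (θ : ℝ) (j : ℕ) : Measurable fun u => stickBreaking θ u j := by
  unfold stickBreaking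
  fun_prop

theorem measurable_stickTuple (θ : ℝ) (K : ℕ) : Measurable (stickTuple θ K) :=
  measurable_pi_lambda _ fun j => measurable_stickBreaking θ j

theorem stickTuple_indepFun (θ : ℝ) (K : ℕ) :
    IndepFun (stickTuple θ K) (fun u => u K) iidUniform := by
  have h : iIndepFun (fun (i : ℕ) (u : ℕ → unitInterval) => u i) iidUniform :=
    iIndepFun_infinitePi (X := fun _ x => x) fun _ => measurable_id
  have h1 := h.indepFun_finset (Finset.range K) {K} (by simp) fun i => measurable_pi_apply i
  -- The first `K` stick-breaking terms read only coordinates below `K`, so the value `0` given to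
  -- the others is immaterial.
  let ext : (Finset.range K → unitInterval) → ℕ → unitInterval :=
    fun w i => if hi : i ∈ Finset.range K then w ⟨i, hi⟩ else 0
  have hext : Measurable ext := by
    refine measurable_pi_lambda _ fun i => ?_
    by_cases hi : i ∈ Finset.range K
    · simp only [ext, hi, dif_pos]
      exact measurable_pi_apply (⟨i, hi⟩ : Finset.range K)
    · simp only [ext, hi, dif_neg, not_false_eq_true]
      exact measurable_const
  have hK : Measurable fun w : ({K} : Finset ℕ) → unitInterval =>
    w ⟨K, Finset.mem_singleton_self K⟩ := measurable_pi_apply _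
  have h2 := h1.comp ((measurable_stickTuple θ K).comp hext) hK
  convert! h2 using 1
  ext u j
  have hj : ∀ i, i ≤ (j : ℕ) → ext (fun i => u i) i = u i := fun i hi => by
    have : i < K := hi.trans_lt j.2
    simp [ext, this]
  simp only [Function.comp, stickTuple, stickBreaking]
  rw [hj j le_rfl]
  congr 1
  exact Finset.prod_congr rfl fun i hi => by rw [hj i (Finset.mem_range.1 hi).le]

theorem map_eval_iidUniform (K : ℕ) : iidUniform.map (fun u => u K) = volume :=
  Measure.infinitePi_map_eval _ K

theorem lintegral_stickTuple_succ (θ : ℝ) (K : ℕ) {H : (Fin (K + 1) → ℝ) → ENNReal}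
    (hH : Measurable H) :
    ∫⁻ u, H (stickTuple θ (K + 1) u) ∂iidUniform =
      ∫⁻ u, (fun x => ∫⁻ y : unitInterval, H (Fin.snoc x ((1 - ∑ j, x j) *
        (1 - (y : ℝ) ^ (1 / θ))))) (stickTuple θ K u) ∂iidUniform := by
  have hm : Measurable fun p : (Fin K → ℝ) × unitInterval =>
      H (Fin.snoc p.1 ((1 - ∑ j, p.1 j) * (1 - (p.2 : ℝ) ^ (1 / θ)))) := by
    refine hH.comp (measurable_pi_lambda _ fun j => ?_)
    induction j using Fin.lastCases with
    | last => simp only [Fin.snoc_last]; fun_prop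
    | cast j => simp only [Fin.snoc_castSucc]; fun_prop
  have hmap := (indepFun_iff_map_prod_eq_prod_map_map (measurable_stickTuple θ K).aemeasurable
    (measurable_pi_apply K).aemeasurable).1 (stickTuple_indepFun θ K)
  rw [map_eval_iidUniform] at hmap
  simp only [stickTuple_succ]
  rw [← lintegral_map (f := fun p : (Fin K → ℝ) × unitInterval =>
      H (Fin.snoc p.1 ((1 - ∑ j, p.1 j) * (1 - (p.2 : ℝ) ^ (1 / θ)))))
      (g := fun u => (stickTuple θ K u, u K)) hm
      ((measurable_stickTuple θ K).prodMk (measurable_pi_apply K)), hmap,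
    lintegral_prod _ hm.aemeasurable, lintegral_map hm.lintegral_prod_right'
      (measurable_stickTuple θ K)]

theorem lintegral_fin_snoc {K : ℕ} {F : (Fin (K + 1) → ℝ) → ENNReal} (hF : Measurable F) :
    ∫⁻ w, F w = ∫⁻ x : Fin K → ℝ, ∫⁻ z : ℝ, F (Fin.snoc x z) := by
  have h := ((volume_preserving_piFinSuccAbove (fun _ : Fin (K + 1) => ℝ) (Fin.last K)).symm _)
  rw [← h.lintegral_comp hF, Measure.volume_eq_prod,
    lintegral_prod_symm (fun a : ℝ × (Fin K → ℝ) =>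
      F ((MeasurableEquiv.piFinSuccAbove (fun _ => ℝ) (Fin.last K)).symm a))
      (hF.comp (MeasurableEquiv.measurable _)).aemeasurable]
  simp [MeasurableEquiv.piFinSuccAbove, Fin.snocEquiv]

/-- The first `K` terms of the stick-breaking sequence have density `gemDensity` on the open
simplex. -/
theorem lintegral_stickTuple {θ : ℝ} (hθ : 0 < θ) (K : ℕ) {H : (Fin K → ℝ) → ENNReal}
    (hH : Measurable H) :
    ∫⁻ u, H (stickTuple θ K u) ∂iidUniform =
      ∫⁻ x in openSimplex K, ENNReal.ofReal (gemDensity θ x) * H x := by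
  induction K with
  | zero =>
    have h1 : ∀ x : Fin 0 → ℝ, H x = H default := fun x => by rw [Subsingleton.elim x default]
    have h2 : openSimplex 0 = Set.univ := by ext; simp [openSimplex]
    simp [h1, h2, gemDensity, volume_pi]
  | succ K ih =>
    have hgem := measurable_gemDensity θ
    have hsnoc : Measurable fun p : (Fin K → ℝ) × ℝ => (Fin.snoc p.1 p.2 : Fin (K + 1) → ℝ) := by
      refine measurable_pi_lambda _ fun j => ?_
      induction j using Fin.lastCases with
      | last => simp only [Fin.snoc_last]; fun_prop
      | cast j => simp only [Fin.snoc_castSucc]; fun_prop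
    have hm : Measurable fun p : (Fin K → ℝ) × unitInterval =>
        H (Fin.snoc p.1 ((1 - ∑ j, p.1 j) * (1 - (p.2 : ℝ) ^ (1 / θ)))) :=
      hH.comp (hsnoc.comp (measurable_fst.prodMk (by fun_prop)))
    rw [lintegral_stickTuple_succ θ K hH, ih hm.lintegral_prod_right',
      ← lintegral_indicator (isOpen_openSimplex (K + 1)).measurableSet,
      ← lintegral_indicator (isOpen_openSimplex K).measurableSet,
      lintegral_fin_snoc (Measurable.indicator (by fun_prop)
        (isOpen_openSimplex (K + 1)).measurableSet)]
    refine lintegral_congr fun x => ?_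
    by_cases hx : x ∈ openSimplex K
    · have hc : 0 < 1 - ∑ j, x j := by linarith [hx.2]
      have hm2 : Measurable fun z : ℝ => ENNReal.ofReal
          (θ * (1 - z / (1 - ∑ i, x i)) ^ (θ - 1) / (1 - ∑ i, x i)) *
            H (Fin.snoc x z) := by
        have : Measurable fun z : ℝ => (Fin.snoc x z : Fin (K + 1) → ℝ) :=
          hsnoc.comp (measurable_const.prodMk measurable_id)
        fun_prop
      rw [Set.indicator_of_mem hx, lintegral_unitInterval_comp hθ hc (fun z => H (Fin.snoc x z)),
        ← lintegral_const_mul _ hm2, ← lintegral_indicator measurableSet_Ioo]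
      refine lintegral_congr fun z => ?_
      by_cases hz : z ∈ Set.Ioo 0 (1 - ∑ j, x j)
      · rw [Set.indicator_of_mem hz, Set.indicator_of_mem (snoc_mem_openSimplex.2 ⟨hx, hz⟩),
          gemDensity_snoc θ hc hz.2.le, ENNReal.ofReal_mul (gemDensity_pos hθ hx).le, mul_assoc]
      · rw [Set.indicator_of_notMem hz,
          Set.indicator_of_notMem fun h => hz (snoc_mem_openSimplex.1 h).2]
    · rw [Set.indicator_of_notMem hx, eq_comm]
      rw [← lintegral_zero (μ := (volume : Measure ℝ))]
      refine lintegral_congr fun z => ?_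
      rw [Set.indicator_of_notMem fun h => hx (snoc_mem_openSimplex.1 h).1]

theorem integral_unitInterval_rpow {θ : ℝ} (hθ : 0 < θ) :
    ∫ y : unitInterval, (y : ℝ) ^ (1 / θ) = θ / (θ + 1) := by
  rw [unitInterval.volume_def,
    integral_subtype_comap measurableSet_Icc (fun y : ℝ => y ^ (1 / θ)),
    integral_Icc_eq_integral_Ioc, ← intervalIntegral.integral_of_le zero_le_one,
    integral_rpow (Or.inl (by have : 0 < 1 / θ := by positivity
                              linarith))]
  have : 1 / θ + 1 ≠ 0 := by positivity
  rw [Real.one_rpow, Real.zero_rpow this]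
  field_simp
  ring

/-- The residual is a product of `K` independent factors `U ^ (1 / θ)`, each of mean `θ / (θ + 1)`.
-/
theorem integral_one_sub_sum_stickTuple {θ : ℝ} (hθ : 0 < θ) (K : ℕ) :
    ∫ u, (1 - ∑ j, stickTuple θ K u j) ∂iidUniform = (θ / (θ + 1)) ^ K := by
  induction K with
  | zero => simp
  | succ K ih =>
    have h1 : ∀ u, 1 - ∑ j, stickTuple θ (K + 1) u j =
        (1 - ∑ j, stickTuple θ K u j) * (u K : ℝ) ^ (1 / θ) := fun u => by
      rw [one_sub_sum_stickTuple, one_sub_sum_stickTuple, Finset.prod_range_succ]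
    have h2 := (stickTuple_indepFun θ K).comp (φ := fun x => 1 - ∑ j, x j)
      (ψ := fun y : unitInterval => (y : ℝ) ^ (1 / θ)) (by fun_prop) (by fun_prop)
    have h3 := h2.integral_fun_mul_eq_mul_integral
      (((Measurable.comp (by fun_prop) (measurable_stickTuple θ K))).aestronglyMeasurable)
      ((Measurable.comp (by fun_prop) (measurable_pi_apply K)).aestronglyMeasurable)
    simp only [Function.comp] at h3
    simp only [h1]
    rw [h3, ih, pow_succ, ← integral_unitInterval_rpow hθ, ← map_eval_iidUniform K, integral_map
      (measurable_pi_apply K).aemeasurable (by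
        exact Measurable.aestronglyMeasurable (by fun_prop))]

/-! ### Riemann sums -/

open scoped Pointwise in
/-- Riemann sums over the grid `{0, 1/n, …, 1}^K`. -/
theorem tendsto_riemannSum_unitCube {K : ℕ} {F : (Fin K → ℝ) → ℝ} (hF : Continuous F)
    (h0 : ∀ x, x ∉ Set.Icc (0 : Fin K → ℝ) 1 → F x = 0) :
    Tendsto (fun n : ℕ => ∑ i : Fin K → Fin (n + 1), F (fun j => ((i j : ℕ) : ℝ) / n) / (n : ℝ) ^ K)
      atTop (𝓝 (∫ x, F x)) := by
  have h := tendsto_tsum_div_pow_atTop_integral (Set.Icc (0 : Fin K → ℝ) 1) F hF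
    (Metric.isBounded_Icc _ _) measurableSet_Icc ((convex_Icc _ _).addHaar_frontier _)
  rw [setIntegral_eq_integral_of_forall_compl_eq_zero h0] at h
  refine h.congr' ?_
  filter_upwards [eventually_gt_atTop 0] with n hn
  have hn' : (0 : ℝ) < n := by exact_mod_cast hn
  have : NeZero n := ⟨hn.ne'⟩
  let e : (Fin K → Fin (n + 1)) → Fin K → ℝ := fun i j => ((i j : ℕ) : ℝ) / n
  have he : Function.Injective e := by
    intro a b hab
    ext j
    have := congrFun hab j
    simp only [e] at this
    rw [div_left_inj' hn'.ne'] at this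
    exact_mod_cast this
  -- The points of the lattice of mesh `1 / n` in the closed cube are exactly the grid points.
  have hrange : Set.Icc (0 : Fin K → ℝ) 1 ∩ (n : ℝ)⁻¹ •
      (Submodule.span ℤ (Set.range (Pi.basisFun ℝ (Fin K))) : Set (Fin K → ℝ)) = Set.range e := by
    ext x
    constructor
    · rintro ⟨⟨hx0, hx1⟩, hx⟩
      have hx2 := BoxIntegral.unitPartition.mem_smul_span_iff.1 hx
      have key : ∀ j, ∃ m : Fin (n + 1), ((m : ℕ) : ℝ) = n * x j := by
        intro j
        obtain ⟨z, hz⟩ := hx2 j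
        rw [eq_intCast] at hz
        have h1 : (0 : ℝ) ≤ z := by
          rw [hz]
          exact mul_nonneg hn'.le (hx0 j)
        have h2 : (z : ℝ) ≤ n := by
          rw [hz]
          exact mul_le_of_le_one_right hn'.le (hx1 j)
        have h1' : 0 ≤ z := by exact_mod_cast h1
        have h2' : z ≤ n := by exact_mod_cast h2
        lift z to ℕ using h1'
        exact ⟨⟨z, by omega⟩, by simpa using hz⟩
      choose m hm using key
      refine ⟨m, ?_⟩
      ext j
      simp only [e]
      rw [hm, mul_div_cancel_left₀ _ hn'.ne']
    · rintro ⟨i, rfl⟩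
      refine ⟨⟨fun j => by simp only [e]; positivity, fun j => ?_⟩, ?_⟩
      · simp only [e, Pi.one_apply]
        rw [div_le_one hn']
        exact_mod_cast Nat.lt_succ_iff.1 (i j).2
      · refine BoxIntegral.unitPartition.mem_smul_span_iff.2 fun j => ⟨((i j : ℕ) : ℤ), ?_⟩
        simp only [e]
        rw [mul_div_cancel₀ _ hn'.ne']
        simp
  rw [hrange, tsum_range F he, tsum_fintype, Fintype.card_fin, Finset.sum_div]

/-! ### Tuples with distinct entries -/

/-- The open simplex without the tuples with repeated entries. -/
def distinctSimplex (K : ℕ) : Set (Fin K → ℝ) := openSimplex K ∩ {x | Function.Injective x}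

theorem isOpen_distinctSimplex (K : ℕ) : IsOpen (distinctSimplex K) := by
  have : {x : Fin K → ℝ | Function.Injective x} = ⋂ i, ⋂ j, {x | x i = x j → i = j} := by
    ext
    simp [Function.Injective]
  refine (isOpen_openSimplex K).inter ?_
  rw [this]
  refine isOpen_iInter_of_finite fun i => isOpen_iInter_of_finite fun j => ?_
  by_cases hij : i = j
  · simp [hij]
  · simpa [hij] using isOpen_ne_fun (continuous_apply i) (continuous_apply j)

/-- Each diagonal `x i = x j` with `i ≠ j` is a proper subspace, hence null. -/
theorem ae_injective_pi (K : ℕ) : ∀ᵐ x : Fin K → ℝ, Function.Injective x := by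
  have h : ∀ i j : Fin K, ∀ᵐ x : Fin K → ℝ, x i = x j → i = j := by
    intro i j
    by_cases hij : i = j
    · simp [hij]
    · let S : Submodule ℝ (Fin K → ℝ) :=
        LinearMap.ker (LinearMap.proj (R := ℝ) (φ := fun _ => ℝ) i - LinearMap.proj j)
      have hS : S ≠ ⊤ := by
        intro htop
        have h1 : Pi.single i (1 : ℝ) ∈ S := htop ▸ Submodule.mem_top
        rw [LinearMap.mem_ker] at h1
        simp [Ne.symm hij] at h1
      have h2 := Measure.addHaar_submodule volume S hS
      rw [measure_eq_zero_iff_ae_notMem] at h2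
      filter_upwards [h2] with x hx hxij
      exact absurd (by simp [S, hxij]) hx
  have h' := ae_all_iff.2 fun i => ae_all_iff.2 (h i)
  filter_upwards [h'] with x hx i j hij using hx i j hij

theorem map_stickTuple_eq_withDensity {θ : ℝ} (hθ : 0 < θ) (K : ℕ) :
    iidUniform.map (stickTuple θ K) =
      (volume.restrict (openSimplex K)).withDensity fun x => ENNReal.ofReal (gemDensity θ x) := by
  ext s hs
  rw [← lintegral_indicator_one hs, lintegral_map (measurable_one.indicator hs)
    (measurable_stickTuple θ K), lintegral_stickTuple hθ K (measurable_one.indicator hs),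
    withDensity_apply _ hs, ← lintegral_indicator hs]
  refine lintegral_congr fun x => ?_
  by_cases hx : x ∈ s <;> simp [hx]

theorem ae_mem_distinctSimplex {θ : ℝ} (hθ : 0 < θ) (K : ℕ) :
    ∀ᵐ x ∂(iidUniform.map (stickTuple θ K)), x ∈ distinctSimplex K := by
  rw [map_stickTuple_eq_withDensity hθ]
  refine (withDensity_absolutelyContinuous _ _).ae_le ?_
  filter_upwards [ae_restrict_mem (isOpen_openSimplex K).measurableSet,
    ae_restrict_of_ae (ae_injective_pi K)] with x h1 h2 using ⟨h1, h2⟩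

theorem integral_stickTuple_comp {θ : ℝ} (hθ : 0 < θ) {K : ℕ} {h : (Fin K → ℝ) → ℝ}
    (hh : Measurable h) (h0 : ∀ x, x ∉ openSimplex K → h x = 0) :
    ∫ u, h (stickTuple θ K u) ∂iidUniform = ∫ x, gemDensity θ x * h x := by
  rw [← integral_map (measurable_stickTuple θ K).aemeasurable hh.aestronglyMeasurable,
    map_stickTuple_eq_withDensity hθ, integral_withDensity_eq_integral_toReal_smul
      (measurable_gemDensity θ K).ennreal_ofReal (by simp),
    ← setIntegral_eq_integral_of_forall_compl_eq_zero (s := openSimplex K)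
      (f := fun x => gemDensity θ x * h x) fun x hx => by rw [h0 x hx, mul_zero]]
  refine setIntegral_congr_fun (isOpen_openSimplex K).measurableSet fun x hx => ?_
  simp only [ENNReal.toReal_ofReal (gemDensity_pos hθ hx).le, smul_eq_mul]

theorem IsCompact.exists_pos_forall_coord_le {K : ℕ} {C : Set (Fin K → ℝ)} (hC : IsCompact C)
    (hpos : ∀ x ∈ C, ∀ j, 0 < x j) : ∃ δ > 0, ∀ x ∈ C, ∀ j, δ ≤ x j := by
  have h : ∀ j, ∃ δ > 0, ∀ x ∈ C, δ ≤ x j := fun j =>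
    hC.exists_forall_le' (continuous_apply j).continuousOn fun x hx => hpos x hx j
  choose δ hδ hδC using h
  have h1 : ∀ᶠ ε in 𝓝[>] (0 : ℝ), ∀ j, ε ≤ δ j := eventually_all.2 fun j => by
    filter_upwards [Ioo_mem_nhdsGT (hδ j)] with ε hε using hε.2.le
  obtain ⟨ε, hε, hε0⟩ := (h1.and self_mem_nhdsWithin).exists
  exact ⟨ε, hε0, fun x hx j => (hε j).trans (hδC j x hx)⟩

/-! ### From moments to size-biased means -/

namespace DecomposableFamily

variable {Obj Irr : Type*} {D : DecomposableFamily Obj Irr}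

/-- The asymptotics of the mixed moments of `k` component counts at distinct sizes, uniformly over
good sequences of families of `k`-tuples with sum bounded away from `n`. -/
def MomentAsymptotics (μ : (n : ℕ+) → Measure (D.OfSize n)) (θ : ℝ) (k : ℕ) : Prop :=
  ∀ F : ℕ+ → Set (Fin k → ℕ), IsGoodSequence F →
    (∃ δ : ℝ, 0 < δ ∧ ∀ n, ∀ i ∈ F n, ((∑ j, i j : ℕ) : ℝ) / (n : ℝ) ≤ 1 - δ) →
    ∀ ε : ℝ, 0 < ε → ∀ᶠ n : ℕ+ in atTop, ∀ i ∈ F n,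
      |(∫ o, ∏ j, (componentCount o (i j) : ℝ) ∂(μ n)) -
          θ ^ k / (1 - ((∑ j, i j : ℕ) : ℝ) / (n : ℝ)) ^ (1 - θ) *
            (1 / ∏ j, (i j : ℝ))| ≤
        ε * (θ ^ k / (1 - ((∑ j, i j : ℕ) : ℝ) / (n : ℝ)) ^ (1 - θ) *
            (1 / ∏ j, (i j : ℝ)))

/-- The weight is a deterministic factor `B` times the product of counts, and `B` times the
predicted moment is exactly the density over `n ^ K`. The relative error `ε` is therefore unchanged.
-/
theorem abs_integral_sizeBiasedWeight_sub_le {n : ℕ+} (μ : Measure (D.OfSize n)) {θ ε : ℝ} {K : ℕ}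
    {i : Fin K → ℕ} (hi : (fun j => (i j : ℝ) / n) ∈ openSimplex K)
    (h : |(∫ o, ∏ j, (componentCount o (i j) : ℝ) ∂μ) -
          θ ^ K / (1 - ((∑ j, i j : ℕ) : ℝ) / (n : ℝ)) ^ (1 - θ) *
            (1 / ∏ j, (i j : ℝ))| ≤
        ε * (θ ^ K / (1 - ((∑ j, i j : ℕ) : ℝ) / (n : ℝ)) ^ (1 - θ) *
            (1 / ∏ j, (i j : ℝ)))) :
    |∫ o, sizeBiasedWeight n i (componentCount o) ∂μ -
        gemDensity θ (fun j => (i j : ℝ) / n) / (n : ℝ) ^ K| ≤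
      ε * (gemDensity θ (fun j => (i j : ℝ) / n) / (n : ℝ) ^ K) := by
  have hn : (0 : ℝ) < n := by exact_mod_cast n.pos
  have hipos : ∀ j, (0 : ℝ) < i j := fun j => by
    have := mul_pos (hi.1 j) hn
    rwa [div_mul_cancel₀ _ hn.ne'] at this
  set A := θ ^ K / (1 - ((∑ j, i j : ℕ) : ℝ) / (n : ℝ)) ^ (1 - θ) * (1 / ∏ j, (i j : ℝ)) with hA
  set B : ℝ := ∏ j, (i j : ℝ) / (n - headSum (fun l => (i l : ℝ)) j) with hB
  have hhead : ∀ j, (n : ℝ) - headSum (fun l => (i l : ℝ)) j =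
      n * (1 - headSum (fun l => (i l : ℝ) / n) j) := fun j => by
    simp only [headSum]
    rw [← Finset.sum_div]
    field_simp
  have hBpos : 0 < B := Finset.prod_pos fun j _ => by
    rw [hhead j]
    exact div_pos (hipos j) (mul_pos hn (one_sub_headSum_pos hi j))
  have h1 : ∫ o, sizeBiasedWeight n i (componentCount o) ∂μ =
      B * ∫ o, ∏ j, (componentCount o (i j) : ℝ) ∂μ := by
    rw [← integral_const_mul]
    congr 1
    ext o
    simp only [sizeBiasedWeight, hB, ← Finset.prod_mul_distrib]
    exact Finset.prod_congr rfl fun j _ => by ring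
  have h2 : gemDensity θ (fun j => (i j : ℝ) / n) / (n : ℝ) ^ K = B * A := by
    have hS : ((∑ j, i j : ℕ) : ℝ) / (n : ℝ) = ∑ j, (i j : ℝ) / n := by
      push_cast
      rw [Finset.sum_div]
    have h3 : 0 < 1 - ∑ j, (i j : ℝ) / n := by linarith [hi.2]
    have hP : ∏ j, (i j : ℝ) ≠ 0 := (Finset.prod_pos fun j _ => hipos j).ne'
    rw [hA, hB, hS, gemDensity, Finset.prod_div_distrib, Finset.prod_congr rfl fun j _ => hhead j,
      Finset.prod_mul_distrib, Finset.prod_const, Finset.card_univ, Fintype.card_fin,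
      show θ - 1 = -(1 - θ) by ring, Real.rpow_neg h3.le]
    field_simp
  rw [h1, h2, ← mul_sub, abs_mul, abs_of_pos hBpos, mul_left_comm]
  gcongr

/-- Compactness of `C` keeps the ratios `i j / n` away from `0` and their sum away from `1`, so the
tuples with `i / n ∈ C` form an admissible good sequence. -/
theorem MomentAsymptotics.eventually_abs_integral_sizeBiasedWeight_sub_le
    {μ : (n : ℕ+) → Measure (D.OfSize n)} {θ : ℝ} {K : ℕ} (hμ : MomentAsymptotics μ θ K)
    {C : Set (Fin K → ℝ)} (hC : IsCompact C) (hCU : C ⊆ distinctSimplex K) {ε : ℝ} (hε : 0 < ε) :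
    ∀ᶠ n : ℕ+ in atTop, ∀ i : Fin K → ℕ, (fun j => (i j : ℝ) / n) ∈ C →
      |∫ o, sizeBiasedWeight n i (componentCount o) ∂(μ n) -
        gemDensity θ (fun j => (i j : ℝ) / n) / (n : ℝ) ^ K| ≤
      ε * (gemDensity θ (fun j => (i j : ℝ) / n) / (n : ℝ) ^ K) := by
  obtain ⟨δ, hδ, hδC⟩ := hC.exists_pos_forall_coord_le fun x hx => (hCU hx).1.1
  obtain ⟨δ', hδ', hδC'⟩ := hC.exists_forall_le' (f := fun x => 1 - ∑ j, x j)
    (by fun_prop) (a := 0) fun x hx => by linarith [(hCU hx).1.2]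
  have hgood : IsGoodSequence fun n : ℕ+ => {i : Fin K → ℕ | (fun j => (i j : ℝ) / n) ∈ C} := by
    refine ⟨fun n i hi => ⟨fun a b hab => (hCU hi).2 (by simp only [hab]), fun j => ?_⟩,
      δ, hδ, fun n i hi j => hδC _ hi j⟩
    have hn : (0 : ℝ) < n := by exact_mod_cast n.pos
    have h1 : 0 < (i j : ℝ) / n := (hCU hi).1.1 j
    constructor
    · rw [Nat.one_le_iff_ne_zero]
      rintro h0
      simp [h0] at h1
    · have h2 : (i j : ℝ) / n ≤ 1 :=
        (Finset.single_le_sum (f := fun j => (i j : ℝ) / n) (fun l _ => by positivity)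
          (Finset.mem_univ j)).trans (hCU hi).1.2.le
      rw [div_le_one hn] at h2
      exact_mod_cast h2
  have hsum : ∃ δ : ℝ, 0 < δ ∧ ∀ n : ℕ+, ∀ i ∈ {i : Fin K → ℕ | (fun j => (i j : ℝ) / n) ∈ C},
      ((∑ j, i j : ℕ) : ℝ) / (n : ℝ) ≤ 1 - δ := by
    refine ⟨δ', hδ', fun n i hi => ?_⟩
    have := hδC' _ hi
    push_cast
    rw [Finset.sum_div]
    linarith
  filter_upwards [hμ _ hgood hsum ε hε] with n hn i hi
  exact abs_integral_sizeBiasedWeight_sub_le (μ n) (hCU hi).1 (hn i hi)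

/-- The expectation of `h`, evaluated at the sizes, divided by `n`, of the first `K` components in
size-biased order; it is only meaningful for `h` vanishing at tuples with repeated entries. -/
noncomputable def sizeBiasedMean {n : ℕ+} (μ : Measure (D.OfSize n)) {K : ℕ}
    (h : (Fin K → ℝ) → ℝ) : ℝ :=
  ∑ i : Fin K → Fin ((n : ℕ) + 1),
    (∫ o, sizeBiasedWeight n (fun j => (i j : ℕ)) (componentCount o) ∂μ) *
      h (fun j => ((i j : ℕ) : ℝ) / n)

/-- Convergence of the size-biased permutation to the stick-breaking sequence, tested against a
continuous function with support in a compact set of tuples with distinct entries. -/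
theorem MomentAsymptotics.tendsto_sizeBiasedMean
    {μ : (n : ℕ+) → Measure (D.OfSize n)} {θ : ℝ} (hθ : 0 < θ) {K : ℕ}
    (hμ : MomentAsymptotics μ θ K) {C : Set (Fin K → ℝ)} (hC : IsCompact C)
    (hCU : C ⊆ distinctSimplex K) {h : (Fin K → ℝ) → ℝ} (hh : Continuous h)
    (h0 : ∀ x, x ∉ C → h x = 0) :
    Tendsto (fun n : ℕ+ => sizeBiasedMean (μ n) h) atTop
      (𝓝 (∫ u, h (stickTuple θ K u) ∂iidUniform)) := by
  -- The density may blow up at the boundary of the simplex, but `h` vanishes outside a compact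
  -- subset of its interior.
  have hcont : Continuous fun x => gemDensity θ x * h x := by
    refine ContinuousOn.continuous_of_tsupport_subset (s := openSimplex K)
      ((continuousOn_gemDensity θ K).mul hh.continuousOn) (isOpen_openSimplex K) ?_
    refine Set.Subset.trans (closure_minimal (fun x hx => ?_) hC.isClosed)
      (hCU.trans Set.inter_subset_left)
    by_contra hxC
    exact hx (by simp [h0 x hxC])
  have hcube : ∀ x, x ∉ Set.Icc (0 : Fin K → ℝ) 1 → h x = 0 := fun x hx => by
    refine h0 x fun hxC => hx ⟨fun j => ((hCU hxC).1.1 j).le, fun j => ?_⟩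
    exact (Finset.single_le_sum (f := x) (fun l _ => ((hCU hxC).1.1 l).le)
      (Finset.mem_univ j)).trans (hCU hxC).1.2.le
  have hcoe : Tendsto (fun n : ℕ+ => (n : ℕ)) atTop atTop := tendsto_PNat_val_atTop_atTop
  have hA := (tendsto_riemannSum_unitCube hcont
    fun x hx => by rw [hcube x hx, mul_zero]).comp hcoe
  have hB := (tendsto_riemannSum_unitCube hcont.abs
    fun x hx => by rw [hcube x hx, mul_zero, abs_zero]).comp hcoe
  rw [integral_stickTuple_comp hθ hh.measurable fun x hx =>
    h0 x fun hxC => hx (hCU hxC).1]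
  set J := ∫ x, |gemDensity θ x * h x|
  have hJ : 0 ≤ J := integral_nonneg fun x => abs_nonneg _
  have hdiff : Tendsto (fun n : ℕ+ => ∑ i : Fin K → Fin ((n : ℕ) + 1),
        (∫ o, sizeBiasedWeight n (fun j => (i j : ℕ)) (componentCount o) ∂(μ n)) *
          h (fun j => ((i j : ℕ) : ℝ) / n) -
        ∑ i : Fin K → Fin ((n : ℕ) + 1), gemDensity θ (fun j => ((i j : ℕ) : ℝ) / n) *
          h (fun j => ((i j : ℕ) : ℝ) / n) / (n : ℝ) ^ K) atTop (𝓝 0) := by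
    rw [Metric.tendsto_nhds]
    intro ε hε
    -- The error is at most the relative error times a Riemann sum tending to `J`, hence eventually
    -- below `J + 1`.
    have hε' : 0 < ε / (J + 1) := by positivity
    filter_upwards [hμ.eventually_abs_integral_sizeBiasedWeight_sub_le hC hCU hε',
      hB.eventually (gt_mem_nhds (lt_add_one J))] with n hn hBn
    rw [Real.dist_0_eq_abs, ← Finset.sum_sub_distrib]
    refine (Finset.abs_sum_le_sum_abs _ _).trans_lt ?_
    calc _ ≤ ∑ i : Fin K → Fin ((n : ℕ) + 1), ε / (J + 1) *
          (|gemDensity θ (fun j => ((i j : ℕ) : ℝ) / n) * h (fun j => ((i j : ℕ) : ℝ) / n)| /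
            (n : ℝ) ^ K) := by
          refine Finset.sum_le_sum fun i _ => ?_
          by_cases hiC : (fun j => ((i j : ℕ) : ℝ) / n) ∈ C
          · have h1 := hn (fun j => (i j : ℕ)) hiC
            have h2 := gemDensity_pos hθ (hCU hiC).1
            rw [mul_div_right_comm, ← sub_mul, abs_mul, abs_mul, abs_of_pos h2,
              mul_div_right_comm, ← mul_assoc]
            gcongr
          · simp [h0 _ hiC]
      _ = ε / (J + 1) * ∑ i : Fin K → Fin ((n : ℕ) + 1),
          (|gemDensity θ (fun j => ((i j : ℕ) : ℝ) / n) * h (fun j => ((i j : ℕ) : ℝ) / n)| /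
            (n : ℝ) ^ K) := by rw [Finset.mul_sum]
      _ < ε / (J + 1) * (J + 1) := by
          gcongr
          exact hBn
      _ = ε := by field_simp
  have := hdiff.add hA
  rw [zero_add] at this
  refine this.congr fun n => ?_
  simp only [Function.comp, sizeBiasedMean]
  ring

end DecomposableFamily

/-! ### Truncation of the Poisson–Dirichlet sequence -/

theorem rpow_unitInterval_nonneg (y : unitInterval) (s : ℝ) : 0 ≤ (y : ℝ) ^ s :=
  Real.rpow_nonneg y.2.1 _

theorem rpow_unitInterval_le_one {θ : ℝ} (hθ : 0 < θ) (y : unitInterval) :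
    (y : ℝ) ^ (1 / θ) ≤ 1 :=
  Real.rpow_le_one y.2.1 y.2.2 (by positivity)

theorem antitone_prod_rpow {θ : ℝ} (hθ : 0 < θ) (u : ℕ → unitInterval) :
    Antitone fun K => ∏ i ∈ Finset.range K, (u i : ℝ) ^ (1 / θ) := by
  refine antitone_nat_of_succ_le fun K => ?_
  rw [Finset.prod_range_succ]
  exact mul_le_of_le_one_right (Finset.prod_nonneg fun _ _ => rpow_unitInterval_nonneg _ _)
    (rpow_unitInterval_le_one hθ _)

theorem stickBreaking_nonneg {θ : ℝ} (hθ : 0 < θ) (u : ℕ → unitInterval) (j : ℕ) :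
    0 ≤ stickBreaking θ u j :=
  mul_nonneg (Finset.prod_nonneg fun _ _ => rpow_unitInterval_nonneg _ _)
    (sub_nonneg.2 (rpow_unitInterval_le_one hθ _))

theorem stickBreaking_le_prod {θ : ℝ} (hθ : 0 < θ) (u : ℕ → unitInterval) {K j : ℕ}
    (hj : K ≤ j) : stickBreaking θ u j ≤ ∏ i ∈ Finset.range K, (u i : ℝ) ^ (1 / θ) :=
  (mul_le_of_le_one_right (Finset.prod_nonneg fun _ _ => rpow_unitInterval_nonneg _ _)
    (sub_le_self _ (rpow_unitInterval_nonneg _ _))).trans (antitone_prod_rpow hθ u hj)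

theorem one_sub_sum_stickTuple_nonneg (θ : ℝ) (K : ℕ) (u : ℕ → unitInterval) :
    0 ≤ 1 - ∑ j, stickTuple θ K u j := by
  rw [one_sub_sum_stickTuple]
  exact Finset.prod_nonneg fun _ _ => rpow_unitInterval_nonneg _ _

theorem one_sub_sum_stickTuple_le_one {θ : ℝ} (hθ : 0 < θ) (K : ℕ) (u : ℕ → unitInterval) :
    1 - ∑ j, stickTuple θ K u j ≤ 1 := by
  rw [one_sub_sum_stickTuple]
  simpa using antitone_prod_rpow hθ u (Nat.zero_le K)

theorem integrable_one_sub_sum_stickTuple {θ : ℝ} (hθ : 0 < θ) (K : ℕ) :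
    Integrable (fun u => 1 - ∑ j, stickTuple θ K u j) iidUniform := by
  refine Integrable.of_bound (C := 1) (Measurable.aestronglyMeasurable
    (measurable_const.sub (Finset.measurable_sum _ fun j _ => measurable_stickBreaking θ j)))
    (ae_of_all _ fun u => ?_)
  rw [Real.norm_eq_abs, abs_of_nonneg (one_sub_sum_stickTuple_nonneg θ K u)]
  exact one_sub_sum_stickTuple_le_one hθ K u

/-- Every term from the `K`-th on is a piece of the stick left after `K` breaks. -/
theorem dist_topSorted_stickTuple_poissonDirichlet_le {θ : ℝ} (hθ : 0 < θ) (K k : ℕ)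
    (u : ℕ → unitInterval) :
    dist (topSorted k (stickTuple θ K u)) (fun j : Fin k => poissonDirichlet θ u j) ≤
      1 - ∑ j, stickTuple θ K u j := by
  rw [dist_pi_le_iff (one_sub_sum_stickTuple_nonneg θ K u)]
  intro j
  rw [Real.dist_eq]
  exact abs_topSorted_sub_sortDesc_le (M := 1) (fun i => stickBreaking_nonneg hθ u i)
    (one_sub_sum_stickTuple_nonneg θ K u) (stickBreaking_nonneg hθ u)
    (fun i => by simpa using stickBreaking_le_prod hθ u (Nat.zero_le i)) (fun i => rfl)
    (fun i hi => by
      rw [one_sub_sum_stickTuple]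
      exact stickBreaking_le_prod hθ u hi) j

theorem tendsto_residual_pow {θ : ℝ} (hθ : 0 < θ) :
    Tendsto (fun K : ℕ => (θ / (θ + 1)) ^ K) atTop (𝓝 0) :=
  tendsto_pow_atTop_nhds_zero_of_lt_one (by positivity) (by rw [div_lt_one] <;> linarith)

/-- The residuals decrease in `K` and their means tend to zero, so they tend to zero almost surely.
-/
theorem ae_tendsto_one_sub_sum_stickTuple {θ : ℝ} (hθ : 0 < θ) :
    ∀ᵐ u ∂iidUniform, Tendsto (fun K => 1 - ∑ j, stickTuple θ K u j) atTop (𝓝 0) := by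
  refine tendsto_of_integral_tendsto_of_antitone (F := fun _ => 0)
    (integrable_one_sub_sum_stickTuple hθ) (integrable_zero _ _ _) ?_
    (ae_of_all _ fun u => ?_) (ae_of_all _ fun u K => one_sub_sum_stickTuple_nonneg θ K u)
  · simpa only [integral_one_sub_sum_stickTuple hθ, integral_zero] using tendsto_residual_pow hθ
  · simpa only [one_sub_sum_stickTuple] using antitone_prod_rpow hθ u

/-- Sorting the first `K` terms is continuous, and these truncations converge almost surely. -/
theorem aemeasurable_poissonDirichlet {θ : ℝ} (hθ : 0 < θ) (k : ℕ) :
    AEMeasurable (fun (u : ℕ → unitInterval) (j : Fin k) => poissonDirichlet θ u j)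
      iidUniform := by
  refine aemeasurable_of_tendsto_metrizable_ae atTop
    (f := fun K u => topSorted k (stickTuple θ K u))
    (fun K => ((lipschitzWith_topSorted K k).continuous.measurable.comp
      (measurable_stickTuple θ K)).aemeasurable) ?_
  filter_upwards [ae_tendsto_one_sub_sum_stickTuple hθ] with u hu
  rw [tendsto_iff_dist_tendsto_zero]
  exact squeeze_zero (fun _ => dist_nonneg)
    (fun K => dist_topSorted_stickTuple_poissonDirichlet_le hθ K k u) hu

/-- A cutoff function for the first `K` terms of the stick-breaking sequence. -/
theorem exists_cutoff_stickTuple {θ : ℝ} (hθ : 0 < θ) (K : ℕ) {η : ℝ} (hη : 0 < η) :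
    ∃ (φ : (Fin K → ℝ) → ℝ) (C : Set (Fin K → ℝ)), Continuous φ ∧ IsCompact C ∧
      C ⊆ distinctSimplex K ∧ (∀ x, x ∉ C → φ x = 0) ∧ (∀ x, 0 ≤ φ x) ∧ (∀ x, φ x ≤ 1) ∧
      1 - η ≤ ∫ u, φ (stickTuple θ K u) ∂iidUniform := by
  have hmeas := measurable_stickTuple θ K
  set P := iidUniform.map (stickTuple θ K) with hP
  have : IsProbabilityMeasure P := Measure.isProbabilityMeasure_map hmeas.aemeasurable
  have hU := isOpen_distinctSimplex K
  -- Inner regularity gives `C₁` of mass above `1 - η`. The cutoff equals one on `C₁` and vanishes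
  -- off a larger compact `C` inside the same open set.
  obtain ⟨C₁, hC₁U, hC₁, hlt⟩ := hU.measurableSet.exists_isCompact_lt_add
    (measure_ne_top P _) (ε := ENNReal.ofReal η) (by simpa using hη)
  obtain ⟨C, hC, hC₁C, hCU⟩ := exists_compact_between hC₁ hU hC₁U
  obtain ⟨φ, hφ1, hφ0, -, hφ⟩ := exists_continuous_one_zero_of_isCompact hC₁
    (isOpen_interior (s := C)).isClosed_compl
    (Set.disjoint_compl_right_iff_subset.2 hC₁C)
  refine ⟨φ, C, φ.continuous, hC, hCU,
    fun x hx => hφ0 fun h => hx (interior_subset h), fun x => (hφ x).1, fun x => (hφ x).2, ?_⟩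
  rw [← integral_map hmeas.aemeasurable φ.continuous.aestronglyMeasurable, ← hP]
  have h1 : P.real C₁ ≤ ∫ x, φ x ∂P := by
    rw [← integral_indicator_one hC₁.measurableSet]
    refine integral_mono ((integrable_const 1).indicator hC₁.measurableSet)
      (Integrable.of_bound (C := 1) φ.continuous.aestronglyMeasurable (ae_of_all _ fun x => ?_))
      fun x => ?_
    · rw [Real.norm_eq_abs, abs_of_nonneg (hφ x).1]
      exact (hφ x).2
    · by_cases hx : x ∈ C₁
      · simp [hx, hφ1 hx]
      · simpa [hx] using (hφ x).1
  have h2 : P (distinctSimplex K) = 1 := by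
    rw [prob_compl_eq_zero_iff hU.measurableSet |>.symm]
    exact ae_mem_distinctSimplex hθ K
  rw [h2, ← ofReal_measureReal, ← ENNReal.ofReal_add measureReal_nonneg hη.le,
    ← ENNReal.ofReal_one, ENNReal.ofReal_lt_ofReal_iff_of_nonneg zero_le_one] at hlt
  linarith

/-! ### Comparison of both sides and conclusion -/

namespace DecomposableFamily

variable {Obj Irr : Type*} {D : DecomposableFamily Obj Irr}

theorem sizeBiasedMean_eq_integral {n : ℕ+} (μ : Measure (D.OfSize n)) [IsFiniteMeasure μ] {K : ℕ}
    (h : (Fin K → ℝ) → ℝ) :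
    sizeBiasedMean μ h = ∫ o, ∑ i : Fin K → Fin ((n : ℕ) + 1),
      sizeBiasedWeight n (fun j => (i j : ℕ)) (componentCount o) *
        h (fun j => ((i j : ℕ) : ℝ) / n) ∂μ := by
  rw [integral_finsetSum _ fun i _ => Integrable.of_finite]
  simp only [integral_mul_const]
  rfl

/-- The normalized sizes of the `k` largest components. -/
noncomputable def largestRatios (k : ℕ) {n : ℕ+} (o : D.OfSize n) (j : Fin k) : ℝ :=
  (largestComponent o j : ℝ) / n

/-- The bound holds object by object. The weights times `φ` sum to at most one; the missing mass
costs at most `M` per unit, and each tuple that counts costs at most `L` times its residual. -/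
theorem abs_integral_largestRatios_sub_sizeBiasedMean_le {n : ℕ+} (μ : Measure (D.OfSize n))
    [IsProbabilityMeasure μ] {K k : ℕ} {φ : (Fin K → ℝ) → ℝ} (hφ0 : ∀ x, 0 ≤ φ x)
    (hφ1 : ∀ x, φ x ≤ 1) (hφ : ∀ x, x ∉ distinctSimplex K → φ x = 0) {f : (Fin k → ℝ) → ℝ}
    {M : ℝ} (hM : ∀ x, |f x| ≤ M) {L : NNReal} (hf : LipschitzWith L f) :
    |∫ o, f (largestRatios k o) ∂μ - sizeBiasedMean μ (fun x => φ x * f (topSorted k x))| ≤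
      M * (1 - sizeBiasedMean μ φ) +
        L * sizeBiasedMean μ (fun x : Fin K → ℝ => φ x * (1 - ∑ j, x j)) := by
  classical
  have hn : (0 : ℝ) < n := by exact_mod_cast n.pos
  have hinj : ∀ i : Fin K → Fin ((n : ℕ) + 1), φ (fun j => ((i j : ℕ) : ℝ) / n) ≠ 0 →
      Function.Injective i := fun i hi a b hab => by
    by_contra hne
    exact hi (hφ _ fun h => hne (h.2 (by simp only [hab])))
  rw [sizeBiasedMean_eq_integral, sizeBiasedMean_eq_integral, sizeBiasedMean_eq_integral,
    ← integral_sub Integrable.of_finite Integrable.of_finite]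
  have h1 : ∀ g g' : D.OfSize n → ℝ, M * (1 - ∫ o, g o ∂μ) + L * ∫ o, g' o ∂μ =
      ∫ o, (M * (1 - g o) + L * g' o) ∂μ := fun g g' => by
    rw [integral_add Integrable.of_finite Integrable.of_finite, integral_const_mul,
      integral_const_mul, integral_sub Integrable.of_finite Integrable.of_finite]
    simp
  rw [h1]
  refine (abs_integral_le_integral_abs).trans
    (integral_mono Integrable.of_finite Integrable.of_finite fun o => ?_)
  simp only
  set w : (Fin K → Fin ((n : ℕ) + 1)) → ℝ := fun i =>
    sizeBiasedWeight n (fun j => (i j : ℕ)) (componentCount o) *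
      φ (fun j => ((i j : ℕ) : ℝ) / n) with hw
  have hw0 : ∀ i, 0 ≤ w i := fun i => by
    by_cases hi : φ (fun j => ((i j : ℕ) : ℝ) / n) = 0
    · simp [hw, hi]
    · exact mul_nonneg (sizeBiasedWeight_nonneg (sum_componentCount_mul o) (hinj i hi)) (hφ0 _)
  have hw1 : ∑ i, w i ≤ 1 := by
    refine le_trans (Finset.sum_le_sum fun i _ => ?_)
      (sum_sizeBiasedWeight_le_one (sum_componentCount_mul o) K)
    split_ifs with hi
    · exact mul_le_of_le_one_right (sizeBiasedWeight_nonneg (sum_componentCount_mul o) hi) (hφ1 _)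
    · have : φ (fun j => ((i j : ℕ) : ℝ) / n) = 0 := by
        by_contra h
        exact hi (hinj i h)
      simp [hw, this]
  have hdiff : ∀ i, w i * |f (largestRatios k o) -
      f (topSorted k fun j => ((i j : ℕ) : ℝ) / n)| ≤
        w i * (L * (1 - ∑ j, ((i j : ℕ) : ℝ) / n)) := fun i => by
    by_cases hwi : w i = 0
    · simp [hwi]
    refine mul_le_mul_of_nonneg_left ?_ (hw0 i)
    have hφi : φ (fun j => ((i j : ℕ) : ℝ) / n) ≠ 0 := right_ne_zero_of_mul hwi
    have hmem : (fun j => ((i j : ℕ) : ℝ) / n) ∈ distinctSimplex K := by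
      by_contra h
      exact hφi (hφ _ h)
    have hc := count_ne_zero_of_sizeBiasedWeight_ne_zero (left_ne_zero_of_mul hwi)
    rw [← Real.dist_eq]
    refine (hf.dist_le_mul _ _).trans (mul_le_mul_of_nonneg_left ?_ L.2)
    rw [dist_comm, dist_pi_le_iff (by linarith [hmem.1.2])]
    intro j
    rw [Real.dist_eq]
    exact abs_topSorted_sub_largestComponent_le o (Fin.val_injective.comp (hinj i hφi)) hc j
  have hsplit : f (largestRatios k o) - ∑ i : Fin K → Fin ((n : ℕ) + 1),
      sizeBiasedWeight n (fun j => (i j : ℕ)) (componentCount o) *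
        (φ (fun j => ((i j : ℕ) : ℝ) / n) * f (topSorted k fun j => ((i j : ℕ) : ℝ) / n)) =
      f (largestRatios k o) * (1 - ∑ i, w i) + ∑ i, w i * (f (largestRatios k o) -
        f (topSorted k fun j => ((i j : ℕ) : ℝ) / n)) := by
    simp only [← mul_assoc, mul_sub, Finset.sum_sub_distrib, ← Finset.sum_mul]
    ring
  rw [hsplit]
  refine (abs_add_le _ _).trans (add_le_add ?_ ?_)
  · rw [abs_mul, abs_of_nonneg (sub_nonneg.2 hw1)]
    exact mul_le_mul_of_nonneg_right (hM _) (sub_nonneg.2 hw1)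
  · refine (Finset.abs_sum_le_sum_abs _ _).trans ?_
    rw [Finset.mul_sum]
    refine Finset.sum_le_sum fun i _ => ?_
    rw [abs_mul, abs_of_nonneg (hw0 i)]
    refine (hdiff i).trans (le_of_eq ?_)
    simp only [hw]
    ring

end DecomposableFamily

/-- The counterpart in the limit: the mass cut off costs `M` per unit, and truncation at `K` costs
`L` times the mean residual. -/
theorem abs_integral_cutoff_sub_poissonDirichlet_le {θ : ℝ} (hθ : 0 < θ) {K k : ℕ}
    {φ : (Fin K → ℝ) → ℝ} (hφc : Continuous φ) (hφ0 : ∀ x, 0 ≤ φ x) (hφ1 : ∀ x, φ x ≤ 1)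
    {f : (Fin k → ℝ) → ℝ} {M : ℝ} (hM : ∀ x, |f x| ≤ M) {L : NNReal} (hf : LipschitzWith L f) :
    |∫ u, φ (stickTuple θ K u) * f (topSorted k (stickTuple θ K u)) ∂iidUniform -
      ∫ u, f (fun j : Fin k => poissonDirichlet θ u j) ∂iidUniform| ≤
      M * (1 - ∫ u, φ (stickTuple θ K u) ∂iidUniform) + L * (θ / (θ + 1)) ^ K := by
  have hmeas := measurable_stickTuple θ K
  have hφi : Integrable (fun u => φ (stickTuple θ K u)) iidUniform :=
    Integrable.of_bound (C := 1) (hφc.measurable.comp hmeas).aestronglyMeasurable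
      (ae_of_all _ fun u => by
        rw [Real.norm_eq_abs, abs_of_nonneg (hφ0 _)]
        exact hφ1 _)
  have hfi : Integrable (fun u => f (fun j : Fin k => poissonDirichlet θ u j)) iidUniform :=
    Integrable.of_bound (C := M) (hf.continuous.measurable.comp_aemeasurable
      (aemeasurable_poissonDirichlet hθ k)).aestronglyMeasurable (ae_of_all _ fun u => hM _)
  have hfS : Integrable (fun u => f (topSorted k (stickTuple θ K u))) iidUniform :=
    Integrable.of_bound (C := M) ((hf.continuous.comp
      (lipschitzWith_topSorted K k).continuous).measurable.comp hmeas).aestronglyMeasurable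
      (ae_of_all _ fun u => hM _)
  have hφf : Integrable (fun u => φ (stickTuple θ K u) * f (topSorted k (stickTuple θ K u)))
      iidUniform :=
    hfS.bdd_mul (c := 1) hφi.aestronglyMeasurable (ae_of_all _ fun u => by
      rw [Real.norm_eq_abs, abs_of_nonneg (hφ0 _)]
      exact hφ1 _)
  have hI1 : Integrable (fun u => M * (1 - φ (stickTuple θ K u))) iidUniform :=
    ((integrable_const _).sub hφi).const_mul _
  have hI2 := (integrable_one_sub_sum_stickTuple hθ K).const_mul (L : ℝ)
  have h1 : M * (1 - ∫ u, φ (stickTuple θ K u) ∂iidUniform) + L * (θ / (θ + 1)) ^ K =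
      ∫ u, (M * (1 - φ (stickTuple θ K u)) + L * (1 - ∑ j, stickTuple θ K u j)) ∂iidUniform := by
    rw [integral_add hI1 hI2, integral_const_mul,
      integral_const_mul, integral_sub (integrable_const _) hφi,
      integral_one_sub_sum_stickTuple hθ]
    simp
  rw [h1, ← integral_sub hφf hfi]
  refine abs_integral_le_integral_abs.trans (integral_mono (hφf.sub hfi).abs
    (hI1.add hI2) fun u => ?_)
  simp only
  have h2 : |f (topSorted k (stickTuple θ K u)) - f (fun j : Fin k => poissonDirichlet θ u j)| ≤
      L * (1 - ∑ j, stickTuple θ K u j) := by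
    rw [← Real.dist_eq]
    exact (hf.dist_le_mul _ _).trans (mul_le_mul_of_nonneg_left
      (dist_topSorted_stickTuple_poissonDirichlet_le hθ K k u) L.2)
  have h3 : φ (stickTuple θ K u) * f (topSorted k (stickTuple θ K u)) -
      f (fun j : Fin k => poissonDirichlet θ u j) =
      (-f (topSorted k (stickTuple θ K u))) * (1 - φ (stickTuple θ K u)) +
      (f (topSorted k (stickTuple θ K u)) - f (fun j : Fin k => poissonDirichlet θ u j)) := by ring
  rw [h3]
  refine (abs_add_le _ _).trans (add_le_add ?_ h2)
  rw [abs_mul, abs_neg, abs_of_nonneg (sub_nonneg.2 (hφ1 _))]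
  exact mul_le_mul_of_nonneg_right (hM _) (sub_nonneg.2 (hφ1 _))

theorem DecomposableFamily.tendsto_integral_largestRatios {Obj Irr : Type*}
    {D : DecomposableFamily Obj Irr} {μ : (n : ℕ+) → Measure (D.OfSize n)}
    [∀ n, IsProbabilityMeasure (μ n)] {θ : ℝ} (hθ : 0 < θ)
    (hμ : ∀ K, 1 ≤ K → MomentAsymptotics μ θ K) {k : ℕ} {f : (Fin k → ℝ) → ℝ}
    {M : ℝ} (hM : ∀ x, |f x| ≤ M) {L : NNReal} (hf : LipschitzWith L f) :
    Tendsto (fun n : ℕ+ => ∫ o, f (largestRatios k o) ∂(μ n)) atTop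
      (𝓝 (∫ u, f (fun j : Fin k => poissonDirichlet θ u j) ∂iidUniform)) := by
  rw [Metric.tendsto_nhds]
  intro ε hε
  have hM0 : 0 ≤ M := (abs_nonneg _).trans (hM 0)
  have hL0 : (0 : ℝ) ≤ L := L.2
  -- The errors are `2Mη + Lη` for the object, `η` for the convergence of means, and `Mη + Lη` for
  -- the limit. Their sum `(3M + 2L + 1)η` stays below `ε`.
  set η := ε / (3 * M + 2 * L + 2) with hηdef
  have hη : 0 < η := by positivity
  obtain ⟨K, hK, hK1⟩ := (((tendsto_residual_pow hθ).eventually (gt_mem_nhds hη)).and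
    (eventually_ge_atTop 1)).exists
  obtain ⟨φ, C, hφc, hC, hCU, hφC, hφ0, hφ1, hφη⟩ := exists_cutoff_stickTuple hθ K hη
  have hres : ∫ u, φ (stickTuple θ K u) * (1 - ∑ j, stickTuple θ K u j) ∂iidUniform < η := by
    refine lt_of_le_of_lt ?_ hK
    rw [← integral_one_sub_sum_stickTuple hθ]
    refine integral_mono_of_nonneg
      (ae_of_all _ fun u => mul_nonneg (hφ0 _) (one_sub_sum_stickTuple_nonneg θ K u))
      (integrable_one_sub_sum_stickTuple hθ K) (ae_of_all _ fun u => ?_)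
    exact mul_le_of_le_one_left (one_sub_sum_stickTuple_nonneg θ K u) (hφ1 _)
  have hS : Continuous (topSorted (K := K) k) := (lipschitzWith_topSorted K k).continuous
  have t1 := (hμ K hK1).tendsto_sizeBiasedMean hθ hC hCU hφc hφC
  have t2 := (hμ K hK1).tendsto_sizeBiasedMean hθ hC hCU
    (h := fun x => φ x * (1 - ∑ j, x j)) (by fun_prop) fun x hx => by rw [hφC x hx, zero_mul]
  have t3 := (hμ K hK1).tendsto_sizeBiasedMean hθ hC hCU
    (h := fun x => φ x * f (topSorted k x)) (hφc.mul (hf.continuous.comp hS))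
    fun x hx => by rw [hφC x hx, zero_mul]
  have hPD := abs_integral_cutoff_sub_poissonDirichlet_le hθ hφc hφ0 hφ1 hM hf
  -- The limit of the means of `φ` is at least `1 - η`, so they eventually exceed `1 - 2η`.
  filter_upwards [t1.eventually (lt_mem_nhds (a := 1 - 2 * η) (by linarith)),
    t2.eventually (gt_mem_nhds hres), (Metric.tendsto_nhds.1 t3) η hη] with n h1 h2 h3
  have h4 := abs_integral_largestRatios_sub_sizeBiasedMean_le (μ n) hφ0 hφ1
    (fun x hx => hφC x fun h => hx (hCU h)) hM hf
  rw [Real.dist_eq] at h3 ⊢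
  have h5 : M * (1 - sizeBiasedMean (μ n) φ) ≤ M * (2 * η) := by
    gcongr
    linarith
  have h6 := mul_le_mul_of_nonneg_left h2.le hL0
  have h7 : M * (1 - ∫ u, φ (stickTuple θ K u) ∂iidUniform) ≤ M * η := by
    gcongr
    linarith
  have h8 := mul_le_mul_of_nonneg_left hK.le hL0
  have h9 : (3 * M + 2 * L + 2) * η = ε := by
    rw [hηdef]
    field_simp
  rw [abs_le] at h4 hPD
  rw [abs_lt] at h3 ⊢
  constructor <;> linarith [h4.1, h4.2, hPD.1, hPD.2, h3.1, h3.2]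

theorem mainTheorem1 {Obj Irr : Type*} (D : DecomposableFamily Obj Irr)
    (μ : (n : ℕ+) → Measure (D.OfSize n)) [∀ n, IsProbabilityMeasure (μ n)]
    (θ : ℝ) (hθ : 0 < θ)
    (hmoments : ∀ k : ℕ, 1 ≤ k → ∀ F : ℕ+ → Set (Fin k → ℕ), IsGoodSequence F →
      (∃ δ : ℝ, 0 < δ ∧ ∀ n, ∀ i ∈ F n, ((∑ j, i j : ℕ) : ℝ) / (n : ℝ) ≤ 1 - δ) →
      ∀ ε : ℝ, 0 < ε → ∀ᶠ n : ℕ+ in atTop, ∀ i ∈ F n,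
        |(∫ o, ∏ j, (DecomposableFamily.componentCount o (i j) : ℝ) ∂(μ n)) -
            θ ^ k / (1 - ((∑ j, i j : ℕ) : ℝ) / (n : ℝ)) ^ (1 - θ) *
              (1 / ∏ j, (i j : ℝ))| ≤
          ε * (θ ^ k / (1 - ((∑ j, i j : ℕ) : ℝ) / (n : ℝ)) ^ (1 - θ) *
              (1 / ∏ j, (i j : ℝ))))
    (k : ℕ) (hk : 1 ≤ k) :
    TendstoInDistribution
      (fun (n : ℕ+) (o : D.OfSize n) (j : Fin k) =>
        (DecomposableFamily.largestComponent o j : ℝ) / (n : ℝ))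
      atTop
      (fun (u : ℕ → unitInterval) (j : Fin k) => poissonDirichlet θ u j)
      μ iidUniform := by
  have hμ : ∀ K, 1 ≤ K → DecomposableFamily.MomentAsymptotics μ θ K := hmoments
  refine ⟨fun n => Measurable.of_discrete.aemeasurable, aemeasurable_poissonDirichlet hθ k, ?_⟩
  refine tendsto_iff_forall_lipschitz_integral_tendsto.2 ?_
  rintro f ⟨C, hC⟩ ⟨L, hf⟩
  -- Boundedness of `f` is given as a bound `C` on the distance between any two values.
  have hM : ∀ x, |f x| ≤ |f 0| + C := fun x => by
    have h1 := hC x 0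
    rw [Real.dist_eq] at h1
    have h2 := abs_sub_abs_le_abs_sub (f x) (f 0)
    linarith
  have h := DecomposableFamily.tendsto_integral_largestRatios hθ hμ hM hf
  simp only [ProbabilityMeasure.coe_mk]
  rw [integral_map (aemeasurable_poissonDirichlet hθ k) hf.continuous.aestronglyMeasurable]
  refine h.congr fun n => ?_
  rw [integral_map Measurable.of_discrete.aemeasurable hf.continuous.aestronglyMeasurable]
  rfl
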